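/- Let $1\le p\le n$ and $0\le k\le p$ be integers, let $x\in\{0,1\}^n$ with $\sum_i x_i=p$ be a first-stage solution, let $0\le \underline c_i\le\overline c_i$ $(1\le i\le n)$ be real cost bounds and let $\Gamma\ge 0$ be a real budget. Put \[ \mathcal U^c=\Big\{(\underline c_i+\delta_i)_{i=1}^n:\ 0\le\delta_i\le\overline c_i-\underline c_i,\ \sum_{i=1}^n\delta_i\le\Gamma\Big\},\qquad \Phi_x^k=\Big\{y\in\{0,1\}^n:\ \sum_{i=1}^n y_i=p,\ \sum_{i=1}^n x_iy_i\ge p-k\Big\}. \] The adversarial recoverable selection problem (AREC) under $\mathcal U^c$ is \[ \max_{c\in\mathcal U^c}\ \min_{y\in\Phi_x^k}\ \sum_{i=1}^n c_iy_i . \] **Theorem.** AREC under $\mathcal U^c$ can be solved in $O(n^2)$ time. More precisely, there are a single program for the real RAM (index arithmetic $+,-$, exact real arithmetic $+,-,\cdot,/$, comparisons, indirect memory access, each operation at unit cost) and an absolute constant $K$ such that, for every input $(n,p,k,x,\underline c,\overline c,\Gamma)$ as above, the program halts after at most $Kn^2$ elementary steps and outputs both the optimal value of AREC and a worst scenario,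 i.e. a $c\in\mathcal U^c$ at which the maximum is attained. -/

import Mathlib

/-! A real RAM with unit costs.  The memory consists of natural-number variables and arrays (used
for indices and counters) and of real variables and arrays, each named by a natural number; a
program mentions only finitely many names.  The machine has no rounding and no conversion
between reals and indices. -/

namespace RealRAM

/-- A memory state. -/
structure State where
  idxVar : ℕ → ℕ
  realVar : ℕ → ℝ
  idxArr : ℕ → ℕ → ℕ
  realArr : ℕ → ℕ → ℝ

/-- Index expressions: literals, variables, sum, truncated difference, array read. -/
inductive IdxExp where
  | lit (m : ℕ)
  | var (v : ℕ)
  | add (e₁ e₂ : IdxExp)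
  | sub (e₁ e₂ : IdxExp)
  | read (a : ℕ) (e : IdxExp)

/-- Real expressions: natural-number literals, variables, the four operations, array read. -/
inductive RealExp where
  | lit (m : ℕ)
  | var (v : ℕ)
  | add (e₁ e₂ : RealExp)
  | sub (e₁ e₂ : RealExp)
  | mul (e₁ e₂ : RealExp)
  | div (e₁ e₂ : RealExp)
  | read (a : ℕ) (e : IdxExp)

/-- Tests: comparisons of two index or two real expressions, and boolean combinations. -/
inductive Test where
  | idxLe (e₁ e₂ : IdxExp)
  | realLe (e₁ e₂ : RealExp)
  | neg (b : Test)
  | conj (b₁ b₂ : Test)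

/-- Programs. -/
inductive Cmd where
  | skip
  | setIdx (v : ℕ) (e : IdxExp)
  | setReal (v : ℕ) (e : RealExp)
  | writeIdx (a : ℕ) (i : IdxExp) (e : IdxExp)
  | writeReal (a : ℕ) (i : IdxExp) (e : RealExp)
  | seq (P Q : Cmd)
  | ite (b : Test) (P Q : Cmd)
  | loop (b : Test) (P : Cmd)

def IdxExp.eval (s : State) : IdxExp → ℕ
  | lit m => m
  | var v => s.idxVar v
  | add e₁ e₂ => e₁.eval s + e₂.eval s
  | sub e₁ e₂ => e₁.eval s - e₂.eval s
  | read a e => s.idxArr a (e.eval s)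

/-- The number of elementary steps in evaluating an index expression: one for each node. -/
def IdxExp.cost : IdxExp → ℕ
  | lit _ => 1
  | var _ => 1
  | add e₁ e₂ => e₁.cost + e₂.cost + 1
  | sub e₁ e₂ => e₁.cost + e₂.cost + 1
  | read _ e => e.cost + 1

/-- Division by zero returns `0`. -/
noncomputable def RealExp.eval (s : State) : RealExp → ℝ
  | lit m => (m : ℝ)
  | var v => s.realVar v
  | add e₁ e₂ => e₁.eval s + e₂.eval s
  | sub e₁ e₂ => e₁.eval s - e₂.eval s
  | mul e₁ e₂ => e₁.eval s * e₂.eval s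
  | div e₁ e₂ => e₁.eval s / e₂.eval s
  | read a e => s.realArr a (e.eval s)

/-- The number of elementary steps in evaluating a real expression: one for each node. -/
def RealExp.cost : RealExp → ℕ
  | lit _ => 1
  | var _ => 1
  | add e₁ e₂ => e₁.cost + e₂.cost + 1
  | sub e₁ e₂ => e₁.cost + e₂.cost + 1
  | mul e₁ e₂ => e₁.cost + e₂.cost + 1
  | div e₁ e₂ => e₁.cost + e₂.cost + 1
  | read _ e => e.cost + 1

def Test.holds (s : State) : Test → Prop
  | idxLe e₁ e₂ => e₁.eval s ≤ e₂.eval s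
  | realLe e₁ e₂ => e₁.eval s ≤ e₂.eval s
  | neg b => ¬ b.holds s
  | conj b₁ b₂ => b₁.holds s ∧ b₂.holds s

def Test.cost : Test → ℕ
  | idxLe e₁ e₂ => e₁.cost + e₂.cost + 1
  | realLe e₁ e₂ => e₁.cost + e₂.cost + 1
  | neg b => b.cost + 1
  | conj b₁ b₂ => b₁.cost + b₂.cost + 1

def State.setIdx (s : State) (v m : ℕ) : State :=
  { s with idxVar := Function.update s.idxVar v m }

def State.setReal (s : State) (v : ℕ) (r : ℝ) : State :=
  { s with realVar := Function.update s.realVar v r }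

def State.writeIdx (s : State) (a i m : ℕ) : State :=
  { s with idxArr := Function.update s.idxArr a (Function.update (s.idxArr a) i m) }

def State.writeReal (s : State) (a i : ℕ) (r : ℝ) : State :=
  { s with realArr := Function.update s.realArr a (Function.update (s.realArr a) i r) }

/-- `Exec P s s' t`: the program `P`, started in the state `s`, halts in the state `s'` after
exactly `t` elementary steps.  (`s'` and `t` are determined by `P` and `s`.) -/
inductive Exec : Cmd → State → State → ℕ → Prop
  | skip (s : State) : Exec .skip s s 1
  | setIdx (s : State) (v : ℕ) (e : IdxExp) :
      Exec (.setIdx v e) s (s.setIdx v (e.eval s)) (e.cost + 1)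
  | setReal (s : State) (v : ℕ) (e : RealExp) :
      Exec (.setReal v e) s (s.setReal v (e.eval s)) (e.cost + 1)
  | writeIdx (s : State) (a : ℕ) (i e : IdxExp) :
      Exec (.writeIdx a i e) s (s.writeIdx a (i.eval s) (e.eval s)) (i.cost + e.cost + 1)
  | writeReal (s : State) (a : ℕ) (i : IdxExp) (e : RealExp) :
      Exec (.writeReal a i e) s (s.writeReal a (i.eval s) (e.eval s)) (i.cost + e.cost + 1)
  | seq {P Q : Cmd} {s s₁ s₂ : State} {t₁ t₂ : ℕ} :
      Exec P s s₁ t₁ → Exec Q s₁ s₂ t₂ → Exec (.seq P Q) s s₂ (t₁ + t₂)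
  | iteTrue {b : Test} {P Q : Cmd} {s s' : State} {t : ℕ} :
      b.holds s → Exec P s s' t → Exec (.ite b P Q) s s' (b.cost + 1 + t)
  | iteFalse {b : Test} {P Q : Cmd} {s s' : State} {t : ℕ} :
      ¬ b.holds s → Exec Q s s' t → Exec (.ite b P Q) s s' (b.cost + 1 + t)
  | loopDone {b : Test} {P : Cmd} {s : State} :
      ¬ b.holds s → Exec (.loop b P) s s (b.cost + 1)
  | loopStep {b : Test} {P : Cmd} {s s₁ s₂ : State} {t₁ t₂ : ℕ} :
      b.holds s → Exec P s s₁ t₁ → Exec (.loop b P) s₁ s₂ t₂ →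
      Exec (.loop b P) s s₂ (b.cost + 1 + t₁ + t₂)

end RealRAM

namespace Selection

/-- The feasible solutions of the selection problem: 0-1 vectors with exactly `p` ones. -/
def feasible (n p : ℕ) : Set (Fin n → ℕ) :=
  {x | (∀ i, x i = 0 ∨ x i = 1) ∧ ∑ i, x i = p}

/-- The recovery set of `x`: the feasible `y` that have at least `p - k` items in common
with `x`. -/
def recoverySet {n : ℕ} (p k : ℕ) (x : Fin n → ℕ) : Set (Fin n → ℕ) :=
  {y | (∀ i, y i = 0 ∨ y i = 1) ∧ ∑ i, y i = p ∧ p - k ≤ ∑ i, x i * y i}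

/-- The continuous budgeted uncertainty set with cost intervals `[lo i, hi i]` and budget `Γ`. -/
def budgetedScenarios {n : ℕ} (lo hi : Fin n → ℝ) (Γ : ℝ) : Set (Fin n → ℝ) :=
  {c | ∃ δ : Fin n → ℝ, (∀ i, 0 ≤ δ i ∧ δ i ≤ hi i - lo i) ∧ ∑ i, δ i ≤ Γ ∧
    ∀ i, c i = lo i + δ i}

/-- The cost of the 0-1 vector `y` under the scenario `c`. -/
def cost {n : ℕ} (c : Fin n → ℝ) (y : Fin n → ℕ) : ℝ := ∑ i, c i * (y i : ℝ)

/-- `v` is the optimal value of the incremental problem: minimise the cost under `c` over the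
recovery set of `x`. -/
def IsIncrementalValue {n : ℕ} (p k : ℕ) (x : Fin n → ℕ) (c : Fin n → ℝ) (v : ℝ) : Prop :=
  IsLeast (cost c '' recoverySet p k x) v

/-- `v` is the optimal value of the adversarial problem: maximise the value of the incremental
problem over all scenarios. -/
def IsAdversarialValue {n : ℕ} (p k : ℕ) (x : Fin n → ℕ) (lo hi : Fin n → ℝ) (Γ v : ℝ) : Prop :=
  IsGreatest {w | ∃ c ∈ budgetedScenarios lo hi Γ, IsIncrementalValue p k x c w} v

/-- `c` is a worst scenario, that is, an optimal solution of the adversarial problem, and `v` is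
the optimal value. -/
def IsAdversarialSolution {n : ℕ} (p k : ℕ) (x : Fin n → ℕ) (lo hi : Fin n → ℝ) (Γ : ℝ)
    (c : Fin n → ℝ) (v : ℝ) : Prop :=
  c ∈ budgetedScenarios lo hi Γ ∧ IsIncrementalValue p k x c v ∧
    IsAdversarialValue p k x lo hi Γ v

/-- The entries of a vector as an array, padded with zeros. -/
def toArray {α : Type} [Zero α] {n : ℕ} (v : Fin n → α) : ℕ → α :=
  fun i => if h : i < n then v ⟨i, h⟩ else 0

/-- The initial memory: `n`, `p`, `k` in the index variables 0, 1, 2, the budget in the real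
variable 0, `x` in the index array 0, `lo` and `hi` in the real arrays 0 and 1; all else is 0. -/
def inputState (n p k : ℕ) (x : Fin n → ℕ) (lo hi : Fin n → ℝ) (Γ : ℝ) : RealRAM.State where
  idxVar := fun v => if v = 0 then n else if v = 1 then p else if v = 2 then k else 0
  realVar := fun v => if v = 0 then Γ else 0
  idxArr := fun a => if a = 0 then toArray x else 0
  realArr := fun a => if a = 0 then toArray lo else if a = 1 then toArray hi else 0

/-- The scenario that is read off a final memory: the first `n` entries of the real array 2. -/
def outputScenario (n : ℕ) (s : RealRAM.State) : Fin n → ℝ := fun i => s.realArr 2 i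

/-- The value that is read off a final memory: the real variable 0. -/
def outputValue (s : RealRAM.State) : ℝ := s.realVar 0

end Selection

/-!
Linear programming duality turns the incremental problem under the costs `c` into the
maximisation, over prices `b ≤ a`, of a function `dual c a b`: an item of the first-stage solution
is priced `a`, any other item `b`. Weak duality is `dual_le_cost`; strong duality,
`exists_dual_eq`, comes from an exchange argument, which also shows that nonnegative costs need
only prices `0 ≤ b ≤ a` with `a` equal to `0` or to one of the costs.

At fixed prices the adversary can only increase an item's cost usefully up to its price or to the
end of its interval, so its optimum is the minimum `advDual` of two functions: `dual` at the upper
costs, and `dual` at the lower costs plus the budget (`dual_le_advDual`); it is reached by serving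
the items greedily (`greedy_scenario`). Hence the adversarial value is the maximum of `advDual`
over `b ≤ a`.

Both functions in that minimum are sums of a concave piecewise linear function of `a` and one of
`b`, with at most `2 n + 1` breakpoints once `0` is added. Between consecutive breakpoints they
are affine, and two affine functions on the plane have a common direction of weak increase;
following it leads to a line where `a` or `b` is a breakpoint, or to the diagonal `a = b`
(`exists_boundary_ge`). So it is enough to maximise along `O(n ^ 2)` segments (`le_of_edgeBound`),
and on each of them the maximum is at an end point or where the two affine functions cross
(`min_affine_le`). With the values at all breakpoints tabulated and the successor of each
breakpoint known, both computed naively in quadratic time, a segment takes constant time.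
Conversely, by concavity every value that the program interpolates is a lower bound for `advDual`
there, hence is guaranteed by the greedy scenario.

Programs are verified with the predicate `Runs`, total correctness with a time bound.
-/

namespace RealRAM

/-! ### Total correctness with a time bound -/

/-- Started in the state `s`, the program `P` halts within `T` elementary steps, in a state
that satisfies `Q`. -/
def Runs (P : Cmd) (s : State) (T : ℕ) (Q : State → Prop) : Prop :=
  ∃ (s' : State) (t : ℕ), Exec P s s' t ∧ t ≤ T ∧ Q s'

/-- The index variables that `P` may assign. -/
def Cmd.idxVars : Cmd → List ℕ
  | setIdx v _ => [v]
  | seq P Q => P.idxVars ++ Q.idxVars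
  | ite _ P Q => P.idxVars ++ Q.idxVars
  | loop _ P => P.idxVars
  | _ => []

/-- The real variables that `P` may assign. -/
def Cmd.realVars : Cmd → List ℕ
  | setReal v _ => [v]
  | seq P Q => P.realVars ++ Q.realVars
  | ite _ P Q => P.realVars ++ Q.realVars
  | loop _ P => P.realVars
  | _ => []

/-- The index arrays that `P` may write to. -/
def Cmd.idxArrs : Cmd → List ℕ
  | writeIdx a _ _ => [a]
  | seq P Q => P.idxArrs ++ Q.idxArrs
  | ite _ P Q => P.idxArrs ++ Q.idxArrs
  | loop _ P => P.idxArrs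
  | _ => []

/-- The real arrays that `P` may write to. -/
def Cmd.realArrs : Cmd → List ℕ
  | writeReal a _ _ => [a]
  | seq P Q => P.realArrs ++ Q.realArrs
  | ite _ P Q => P.realArrs ++ Q.realArrs
  | loop _ P => P.realArrs
  | _ => []

/-- The states `s` and `s'` agree at every name that `P` does not assign. -/
structure Frame (P : Cmd) (s s' : State) : Prop where
  idxVar : ∀ v, v ∉ P.idxVars → s'.idxVar v = s.idxVar v
  realVar : ∀ v, v ∉ P.realVars → s'.realVar v = s.realVar v
  idxArr : ∀ a, a ∉ P.idxArrs → s'.idxArr a = s.idxArr a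
  realArr : ∀ a, a ∉ P.realArrs → s'.realArr a = s.realArr a

theorem Frame.refl (P : Cmd) (s : State) : Frame P s s :=
  ⟨fun _ _ => rfl, fun _ _ => rfl, fun _ _ => rfl, fun _ _ => rfl⟩

theorem Frame.trans {P : Cmd} {s₁ s₂ s₃ : State} (h : Frame P s₁ s₂) (h' : Frame P s₂ s₃) :
    Frame P s₁ s₃ :=
  ⟨fun v hv => (h'.idxVar v hv).trans (h.idxVar v hv),
   fun v hv => (h'.realVar v hv).trans (h.realVar v hv),
   fun a ha => (h'.idxArr a ha).trans (h.idxArr a ha),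
   fun a ha => (h'.realArr a ha).trans (h.realArr a ha)⟩

theorem Frame.mono {P Q : Cmd} {s s' : State} (h : Frame P s s')
    (h₁ : P.idxVars ⊆ Q.idxVars) (h₂ : P.realVars ⊆ Q.realVars)
    (h₃ : P.idxArrs ⊆ Q.idxArrs) (h₄ : P.realArrs ⊆ Q.realArrs) : Frame Q s s' :=
  ⟨fun v hv => h.idxVar v fun h' => hv (h₁ h'), fun v hv => h.realVar v fun h' => hv (h₂ h'),
   fun a ha => h.idxArr a fun h' => ha (h₃ h'), fun a ha => h.realArr a fun h' => ha (h₄ h')⟩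

theorem Exec.frame {P : Cmd} {s s' : State} {t : ℕ} (h : Exec P s s' t) : Frame P s s' := by
  induction h with
  | skip s => exact Frame.refl _ _
  | setIdx s v e =>
    exact ⟨fun w hw => Function.update_of_ne (by simpa [Cmd.idxVars] using hw) _ _,
      fun _ _ => rfl, fun _ _ => rfl, fun _ _ => rfl⟩
  | setReal s v e =>
    exact ⟨fun _ _ => rfl, fun w hw => Function.update_of_ne (by simpa [Cmd.realVars] using hw) _ _,
      fun _ _ => rfl, fun _ _ => rfl⟩
  | writeIdx s a i e =>
    exact ⟨fun _ _ => rfl, fun _ _ => rfl,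
      fun w hw => Function.update_of_ne (by simpa [Cmd.idxArrs] using hw) _ _, fun _ _ => rfl⟩
  | writeReal s a i e =>
    exact ⟨fun _ _ => rfl, fun _ _ => rfl, fun _ _ => rfl,
      fun w hw => Function.update_of_ne (by simpa [Cmd.realArrs] using hw) _ _⟩
  | seq _ _ ih₁ ih₂ =>
    refine Frame.trans (ih₁.mono ?_ ?_ ?_ ?_) (ih₂.mono ?_ ?_ ?_ ?_) <;>
      simp [Cmd.idxVars, Cmd.realVars, Cmd.idxArrs, Cmd.realArrs]
  | iteTrue _ _ ih =>
    refine ih.mono ?_ ?_ ?_ ?_ <;> simp [Cmd.idxVars, Cmd.realVars, Cmd.idxArrs, Cmd.realArrs]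
  | iteFalse _ _ ih =>
    refine ih.mono ?_ ?_ ?_ ?_ <;> simp [Cmd.idxVars, Cmd.realVars, Cmd.idxArrs, Cmd.realArrs]
  | loopDone _ => exact Frame.refl _ _
  | loopStep _ _ _ ih₁ ih₂ =>
    refine Frame.trans (ih₁.mono ?_ ?_ ?_ ?_) ih₂ <;>
      simp [Cmd.idxVars, Cmd.realVars, Cmd.idxArrs, Cmd.realArrs]

theorem Runs.imp {P : Cmd} {s : State} {T T' : ℕ} {Q Q' : State → Prop} (h : Runs P s T Q)
    (hT : T ≤ T') (hQ : ∀ s', Frame P s s' → Q s' → Q' s') : Runs P s T' Q' := by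
  obtain ⟨s', t, he, ht, hq⟩ := h
  exact ⟨s', t, he, ht.trans hT, hQ s' he.frame hq⟩

theorem Runs.seq {P P' : Cmd} {s : State} {T T' : ℕ} {R Q : State → Prop} (h : Runs P s T R)
    (h' : ∀ s', Frame P s s' → R s' → Runs P' s' T' Q) : Runs (.seq P P') s (T + T') Q := by
  obtain ⟨s₁, t₁, he, ht, hr⟩ := h
  obtain ⟨s₂, t₂, he', ht', hq⟩ := h' s₁ he.frame hr
  exact ⟨s₂, _, he.seq he', Nat.add_le_add ht ht', hq⟩

/-- The weakest precondition of a program without loops; for a program with a loop it is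
`False`. -/
def Cmd.wp : Cmd → (State → Prop) → State → Prop
  | skip, Q, s => Q s
  | setIdx v e, Q, s => Q (s.setIdx v (e.eval s))
  | setReal v e, Q, s => Q (s.setReal v (e.eval s))
  | writeIdx a i e, Q, s => Q (s.writeIdx a (i.eval s) (e.eval s))
  | writeReal a i e, Q, s => Q (s.writeReal a (i.eval s) (e.eval s))
  | seq P P', Q, s => P.wp (P'.wp Q) s
  | ite b P P', Q, s => (b.holds s → P.wp Q s) ∧ (¬ b.holds s → P'.wp Q s)
  | loop _ _, _, _ => False

/-- A bound on the running time of a program without loops. -/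
def Cmd.size : Cmd → ℕ
  | skip => 1
  | setIdx _ e => e.cost + 1
  | setReal _ e => e.cost + 1
  | writeIdx _ i e => i.cost + e.cost + 1
  | writeReal _ i e => i.cost + e.cost + 1
  | seq P P' => P.size + P'.size
  | ite b P P' => b.cost + 1 + (P.size + P'.size)
  | loop _ _ => 0

theorem Runs.of_wp {P : Cmd} {s : State} {T : ℕ} {Q : State → Prop} (hT : P.size ≤ T)
    (h : P.wp Q s) : Runs P s T Q := by
  suffices H : Runs P s P.size Q from H.imp hT fun _ _ hq => hq
  clear hT
  induction P generalizing s Q with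
  | skip => exact ⟨_, _, .skip s, le_rfl, h⟩
  | setIdx v e => exact ⟨_, _, .setIdx s v e, le_rfl, h⟩
  | setReal v e => exact ⟨_, _, .setReal s v e, le_rfl, h⟩
  | writeIdx a i e => exact ⟨_, _, .writeIdx s a i e, le_rfl, h⟩
  | writeReal a i e => exact ⟨_, _, .writeReal s a i e, le_rfl, h⟩
  | seq P P' ih ih' => exact (ih h).seq fun s' _ hs' => ih' hs'
  | ite b P P' ih ih' =>
    by_cases hb : b.holds s
    · obtain ⟨s', t, he, ht, hq⟩ := ih (h.1 hb)
      exact ⟨s', _, .iteTrue hb he, by simp only [Cmd.size]; omega, hq⟩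
    · obtain ⟨s', t, he, ht, hq⟩ := ih' (h.2 hb)
      exact ⟨s', _, .iteFalse hb he, by simp only [Cmd.size]; omega, hq⟩
  | loop b P => exact h.elim

/-- `for v = 0, …, b - 1 do P`, where `v` and `b` name index variables. -/
def Cmd.forLoop (v b : ℕ) (P : Cmd) : Cmd :=
  .seq (.setIdx v (.lit 0)) (.loop (.idxLe (.add (.var v) (.lit 1)) (.var b))
    (.seq P (.setIdx v (.add (.var v) (.lit 1)))))

/-- The invariant rule for counting loops.  Whatever the loop does not assign may be taken to be
unchanged at every pass. -/
theorem Runs.forLoop {v b N T : ℕ} {P : Cmd} {s : State} (I : ℕ → State → Prop)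
    (hb : s.idxVar b = N) (hvb : b ≠ v) (hv : v ∉ P.idxVars) (hbP : b ∉ P.idxVars)
    (h0 : I 0 (s.setIdx v 0))
    (hstep : ∀ i < N, ∀ s', Frame (Cmd.forLoop v b P) s s' → s'.idxVar v = i → I i s' →
      Runs P s' T fun s'' => I (i + 1) (s''.setIdx v (i + 1))) :
    Runs (Cmd.forLoop v b P) s ((N + 1) * (T + 10)) (I N) := by
  have key : ∀ r i s', i + r = N → Frame (Cmd.forLoop v b P) s s' → s'.idxVar v = i → I i s' →
      Runs (.loop (.idxLe (.add (.var v) (.lit 1)) (.var b))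
        (.seq P (.setIdx v (.add (.var v) (.lit 1))))) s' (r * (T + 10) + 6) (I N) := by
    intro r
    induction r with
    | zero =>
      intro i s' hi hf hvi hI
      have hbs : s'.idxVar b = N := by
        rw [hf.idxVar b, hb]; simp [Cmd.forLoop, Cmd.idxVars, hvb, hbP]
      have hiN : i = N := by omega
      refine ⟨s', _, .loopDone ?_, ?_, hiN ▸ hI⟩
      · simp only [Test.holds, IdxExp.eval, hvi, hbs]; omega
      · simp [Test.cost, IdxExp.cost]
    | succ r ih =>
      intro i s' hi hf hvi hI
      have hbs : s'.idxVar b = N := by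
        rw [hf.idxVar b, hb]; simp [Cmd.forLoop, Cmd.idxVars, hvb, hbP]
      obtain ⟨s₁, t₁, he₁, ht₁, hq₁⟩ := hstep i (by omega) s' hf hvi hI
      have hv₁ : s₁.idxVar v = i := by rw [he₁.frame.idxVar v hv, hvi]
      have he₂ := Exec.setIdx s₁ v (.add (.var v) (.lit 1))
      have hval : IdxExp.eval s₁ (.add (.var v) (.lit 1)) = i + 1 := by
        simp [IdxExp.eval, hv₁]
      rw [hval] at he₂
      have hbody := he₁.seq he₂
      obtain ⟨s₂, t₂, he₃, ht₂, hq₂⟩ := ih (i + 1) (s₁.setIdx v (i + 1)) (by omega)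
        (hf.trans (hbody.frame.mono (by simp [Cmd.forLoop, Cmd.idxVars])
          (by simp [Cmd.forLoop, Cmd.realVars]) (by simp [Cmd.forLoop, Cmd.idxArrs])
          (by simp [Cmd.forLoop, Cmd.realArrs]))) (by simp [State.setIdx]) hq₁
      refine ⟨s₂, _, .loopStep ?_ hbody he₃, ?_, hq₂⟩
      · simp only [Test.holds, IdxExp.eval, hvi, hbs]; omega
      · simp only [Test.cost, IdxExp.cost]
        rw [Nat.succ_mul]; omega
  have hinit := Exec.setIdx s v (.lit 0)
  obtain ⟨s', t, he, ht, hq⟩ := key N 0 (s.setIdx v 0) (by omega)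
    (hinit.frame.mono (by simp [Cmd.forLoop, Cmd.idxVars]) (by simp [Cmd.realVars])
      (by simp [Cmd.idxArrs]) (by simp [Cmd.realArrs])) (by simp [State.setIdx]) h0
  refine ⟨s', _, hinit.seq he, ?_, hq⟩
  simp only [IdxExp.cost]
  rw [Nat.succ_mul]; omega

end RealRAM

namespace Selection

/-! ### Duality for the incremental problem -/

/-- `μ t - ∑ (t - c i)⁺`, the sum running over the items with `x i = q`. -/
noncomputable def hinge {n : ℕ} (μ : ℝ) (x : Fin n → ℕ) (q : ℕ) (c : Fin n → ℝ) (t : ℝ) : ℝ :=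
  μ * t - ∑ i, if x i = q then max 0 (t - c i) else 0

/-- The objective of the linear programming dual of the incremental problem.  The dual variable
`b` is the price of an item outside the first-stage solution and `a` that of an item inside it. -/
noncomputable def dual {n : ℕ} (p k : ℕ) (x : Fin n → ℕ) (c : Fin n → ℝ) (a b : ℝ) : ℝ :=
  hinge ((p - k : ℕ) : ℝ) x 1 c a + hinge (k : ℝ) x 0 c b

theorem dual_eq {n p k : ℕ} {x : Fin n → ℕ} (hx : ∀ i, x i = 0 ∨ x i = 1) (c : Fin n → ℝ)
    (a b : ℝ) : dual p k x c a b = ((p - k : ℕ) : ℝ) * a + k * b -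
      ∑ i, max 0 ((if x i = 1 then a else b) - c i) := by
  have h : ∑ i, max 0 ((if x i = 1 then a else b) - c i) =
      (∑ i, if x i = 1 then max 0 (a - c i) else 0) +
        ∑ i, if x i = 0 then max 0 (b - c i) else 0 := by
    rw [← Finset.sum_add_distrib]
    refine Finset.sum_congr rfl fun i _ => ?_
    rcases hx i with h | h <;> simp [h]
  rw [dual, hinge, hinge, h]; ring

theorem sum_price_mul {n : ℕ} {x y : Fin n → ℕ} (hx : ∀ i, x i = 0 ∨ x i = 1) (a b : ℝ) :
    ∑ i, (if x i = 1 then a else b) * (y i : ℝ) =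
      b * ((∑ i, y i : ℕ) : ℝ) + (a - b) * ((∑ i, x i * y i : ℕ) : ℝ) := by
  push_cast
  rw [Finset.mul_sum, Finset.mul_sum, ← Finset.sum_add_distrib]
  refine Finset.sum_congr rfl fun i _ => ?_
  rcases hx i with h | h <;> simp [h]; ring

theorem dual_le_cost {n p k : ℕ} {x y : Fin n → ℕ} (hx : ∀ i, x i = 0 ∨ x i = 1) (hk : k ≤ p)
    (hy : y ∈ recoverySet p k x) (c : Fin n → ℝ) {a b : ℝ} (hab : b ≤ a) :
    dual p k x c a b ≤ cost c y := by
  obtain ⟨hy01, hyp, hyk⟩ := hy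
  rw [dual_eq hx, cost]
  have h1 : ∑ i, (if x i = 1 then a else b) * (y i : ℝ) -
      ∑ i, max 0 ((if x i = 1 then a else b) - c i) ≤ ∑ i, c i * (y i : ℝ) := by
    rw [← Finset.sum_sub_distrib]
    refine Finset.sum_le_sum fun i _ => ?_
    generalize (if x i = 1 then a else b) = t
    have h0 := le_max_left 0 (t - c i)
    have h1 := le_max_right 0 (t - c i)
    rcases hy01 i with h | h <;> simp only [h] <;> push_cast <;> linarith
  rw [sum_price_mul hx, hyp] at h1
  have h2 : ((p - k : ℕ) : ℝ) ≤ ((∑ i, x i * y i : ℕ) : ℝ) := by exact_mod_cast hyk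
  have h3 : ((p - k : ℕ) : ℝ) = p - k := by push_cast [hk]; ring
  have h4 := mul_le_mul_of_nonneg_left h2 (sub_nonneg.2 hab)
  rw [h3] at h4 ⊢
  linarith

/-- Complementary slackness. -/
theorem cost_le_dual {n p k : ℕ} {x y : Fin n → ℕ} (hx : ∀ i, x i = 0 ∨ x i = 1) (hk : k ≤ p)
    (hy : y ∈ recoverySet p k x) {c : Fin n → ℝ} {a b : ℝ}
    (hab : a = b ∨ ∑ i, x i * y i = p - k)
    (h1 : ∀ i, y i = 1 → c i ≤ if x i = 1 then a else b)
    (h0 : ∀ i, y i = 0 → (if x i = 1 then a else b) ≤ c i) :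
    cost c y ≤ dual p k x c a b := by
  obtain ⟨hy01, hyp, hyk⟩ := hy
  rw [dual_eq hx, cost]
  have h2 : ∑ i, c i * (y i : ℝ) ≤
      ∑ i, (if x i = 1 then a else b) * (y i : ℝ) -
        ∑ i, max 0 ((if x i = 1 then a else b) - c i) := by
    rw [← Finset.sum_sub_distrib]
    refine Finset.sum_le_sum fun i _ => ?_
    have h0 := h0 i
    have h1 := h1 i
    generalize (if x i = 1 then a else b) = t at *
    rcases hy01 i with h | h
    · rw [max_eq_left (by linarith [h0 h])]; simp [h]
    · rw [max_eq_right (by linarith [h1 h])]; simp [h]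
  rw [sum_price_mul hx, hyp] at h2
  have h3 : ((p - k : ℕ) : ℝ) = p - k := by push_cast [hk]; ring
  rcases hab with rfl | h
  · rw [sub_self, zero_mul] at h2; rw [h3]; linarith
  · rw [h] at h2; rw [h3] at h2 ⊢; linarith

/-- The exchange argument: in an optimal solution, a chosen item is not more expensive than an
item that is not chosen and could take its place. -/
theorem le_of_swap {n p k : ℕ} {x y : Fin n → ℕ} {c : Fin n → ℝ}
    (hy : y ∈ recoverySet p k x) (hmin : ∀ z ∈ recoverySet p k x, cost c y ≤ cost c z)
    {i j : Fin n} (hi : y i = 1) (hj : y j = 0)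
    (h : x i ≤ x j ∨ p - k + x i ≤ ∑ i, x i * y i) : c i ≤ c j := by
  obtain ⟨hy01, hyp, hyk⟩ := hy
  have hij : i ≠ j := by rintro rfl; omega
  set z : Fin n → ℕ := fun l => if l = j then 1 else if l = i then 0 else y l with hz
  have hzl : ∀ l, z l + (if l = i then 1 else 0) = y l + (if l = j then 1 else 0) := by
    intro l
    simp only [hz]
    by_cases h1 : l = j
    · subst h1; simp [hj, hij.symm]
    · by_cases h2 : l = i
      · subst h2; simp [hi, h1]
      · simp [h1, h2]
  have hsum : ∑ l, z l = p := by
    have := Finset.sum_congr (rfl : Finset.univ = Finset.univ) fun l _ => hzl l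
    simp only [Finset.sum_add_distrib, Finset.sum_ite_eq', Finset.mem_univ, if_true] at this
    omega
  have hxsum : ∑ l, x l * z l + x i = ∑ l, x l * y l + x j := by
    have := Finset.sum_congr (rfl : Finset.univ = Finset.univ)
      fun l _ => congrArg (x l * ·) (hzl l)
    simpa only [mul_add, mul_ite, mul_one, mul_zero, Finset.sum_add_distrib, Finset.sum_ite_eq',
      Finset.mem_univ, if_true] using this
  have hcsum : cost c z + c i = cost c y + c j := by
    have := Finset.sum_congr (rfl : Finset.univ = Finset.univ)
      fun l _ => congrArg (fun m : ℕ => c l * (m : ℝ)) (hzl l)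
    simpa only [cost, Nat.cast_add, Nat.cast_ite, Nat.cast_one, Nat.cast_zero, mul_add, mul_ite,
      mul_one, mul_zero, Finset.sum_add_distrib, Finset.sum_ite_eq', Finset.mem_univ,
      if_true] using this
  have hzmem : z ∈ recoverySet p k x := by
    refine ⟨fun l => ?_, hsum, by omega⟩
    simp only [hz]
    split_ifs
    · exact Or.inr rfl
    · exact Or.inl rfl
    · exact hy01 l
  linarith [hmin z hzmem]

theorem recoverySet_finite {n : ℕ} (p k : ℕ) (x : Fin n → ℕ) : (recoverySet p k x).Finite := by
  refine (Set.Finite.pi' fun _ : Fin n => Set.finite_Iic 1).subset ?_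
  rintro y ⟨h, -⟩ i
  rcases h i with h | h <;> simp [h]

theorem mem_recoverySet_self {n p k : ℕ} {x : Fin n → ℕ} (hx : x ∈ feasible n p) :
    x ∈ recoverySet p k x := by
  refine ⟨hx.1, hx.2, ?_⟩
  have : ∑ i, x i * x i = ∑ i, x i :=
    Finset.sum_congr rfl fun i _ => by rcases hx.1 i with h | h <;> simp [h]
  rw [this, hx.2]; omega

theorem exists_bound {n : ℕ} (c : Fin n → ℝ) (S : Finset (Fin n)) :
    ∃ b, 0 ≤ b ∧ (b = 0 ∨ ∃ i ∈ S, b = c i) ∧ ∀ i ∈ S, c i ≤ b := by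
  induction S using Finset.induction_on with
  | empty => exact ⟨0, le_rfl, Or.inl rfl, by simp⟩
  | insert j S _ ih =>
    obtain ⟨b, hb, hb', hS⟩ := ih
    rcases le_total (c j) b with h | h
    · refine ⟨b, hb, hb'.imp id ?_, by simpa [h] using hS⟩
      rintro ⟨i, hi, rfl⟩
      exact ⟨i, by simp [hi], rfl⟩
    · refine ⟨c j, hb.trans h, Or.inr ⟨j, by simp, rfl⟩, ?_⟩
      simpa using fun i hi => (hS i hi).trans h

/-- Strong duality for the incremental problem with nonnegative costs. -/
theorem exists_dual_eq {n p k : ℕ} {x : Fin n → ℕ} (hx : x ∈ feasible n p) (hk : k ≤ p)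
    {c : Fin n → ℝ} (hc : ∀ i, 0 ≤ c i) :
    ∃ y ∈ recoverySet p k x, ∃ a b, 0 ≤ b ∧ b ≤ a ∧ (a = 0 ∨ ∃ i, a = c i) ∧
      cost c y ≤ dual p k x c a b := by
  obtain ⟨y, hy, hmin⟩ := Set.exists_min_image _ (cost c) (recoverySet_finite p k x)
    ⟨x, mem_recoverySet_self hx⟩
  refine ⟨y, hy, ?_⟩
  have hy01 := hy.1
  rcases hy.2.2.eq_or_lt with htight | hslack
  · obtain ⟨b, hb0, hb, hbS⟩ := exists_bound c {i | y i = 1 ∧ x i = 0}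
    obtain ⟨a, ha0, ha, haS⟩ := exists_bound c {i | y i = 1 ∧ x i = 1}
    simp only [Finset.mem_filter, Finset.mem_univ, true_and] at hb hbS ha haS
    refine ⟨max b a, b, hb0, le_max_left _ _, ?_,
      cost_le_dual hx.1 hk hy (Or.inr htight.symm) ?_ ?_⟩
    · rcases le_total b a with h | h
      · rw [max_eq_right h]; exact ha.imp id fun ⟨i, _, h⟩ => ⟨i, h⟩
      · rw [max_eq_left h]; exact hb.imp id fun ⟨i, _, h⟩ => ⟨i, h⟩
    · intro i hi
      rcases hx.1 i with h | h
      · simpa [h] using hbS i ⟨hi, h⟩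
      · simpa [h] using Or.inr (haS i ⟨hi, h⟩)
    · intro j hj
      have hbj : b ≤ c j := by
        rcases hb with rfl | ⟨i, ⟨hi, hxi⟩, rfl⟩
        · exact hc j
        · exact le_of_swap hy hmin hi hj (Or.inl (by omega))
      rcases hx.1 j with h | h
      · simpa [h] using hbj
      · have haj : a ≤ c j := by
          rcases ha with rfl | ⟨i, ⟨hi, hxi⟩, rfl⟩
          · exact hc j
          · exact le_of_swap hy hmin hi hj (Or.inl (by omega))
        simpa [h] using ⟨hbj, haj⟩
  · obtain ⟨b, hb0, hb, hbS⟩ := exists_bound c {i | y i = 1}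
    simp only [Finset.mem_filter, Finset.mem_univ, true_and] at hb hbS
    refine ⟨b, b, hb0, le_rfl, hb.imp id fun ⟨i, _, h⟩ => ⟨i, h⟩,
      cost_le_dual hx.1 hk hy (Or.inl rfl) ?_ ?_⟩
    · intro i hi; simpa using hbS i hi
    · intro j hj
      simp only [ite_self]
      rcases hb with rfl | ⟨i, hi, rfl⟩
      · exact hc j
      · exact le_of_swap hy hmin hi hj (Or.inr (by rcases hx.1 i with h | h <;> omega))

/-! ### Duality for the adversarial problem -/

/-- The objective of the adversarial problem as a function of the dual prices: the adversary
either raises all useful costs as far as their intervals allow, or spends the whole budget. -/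
noncomputable def advDual {n : ℕ} (p k : ℕ) (x : Fin n → ℕ) (lo hi : Fin n → ℝ) (Γ a b : ℝ) : ℝ :=
  min (dual p k x hi a b) (dual p k x lo a b + Γ)

theorem dual_le_advDual {n p k : ℕ} {x : Fin n → ℕ} (hx : ∀ i, x i = 0 ∨ x i = 1)
    {lo hi c : Fin n → ℝ} {Γ : ℝ} (hc : c ∈ budgetedScenarios lo hi Γ) (a b : ℝ) :
    dual p k x c a b ≤ advDual p k x lo hi Γ a b := by
  obtain ⟨δ, hδ, hΓ, hc⟩ := hc
  refine le_min ?_ ?_ <;> rw [dual_eq hx, dual_eq hx]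
  · refine sub_le_sub_left (Finset.sum_le_sum fun i _ => max_le_max le_rfl ?_) _
    linarith [hc i, (hδ i).2]
  · have : ∑ i, max 0 ((if x i = 1 then a else b) - lo i) ≤
        ∑ i, max 0 ((if x i = 1 then a else b) - c i) + ∑ i, δ i := by
      rw [← Finset.sum_add_distrib]
      refine Finset.sum_le_sum fun i _ => ?_
      generalize (if x i = 1 then a else b) = t
      rw [hc i]
      refine max_le (add_nonneg (le_max_left _ _) (hδ i).1) ?_
      linarith [le_max_right 0 (t - (lo i + δ i))]
    linarith

/-- The part of the budget `Γ` that remains when the items `0, …, i - 1` have been served in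
turn, item `j` taking `m j` or, if less remains, all of it. -/
noncomputable def remaining (Γ : ℝ) (m : ℕ → ℝ) : ℕ → ℝ
  | 0 => Γ
  | i + 1 => remaining Γ m i - min (m i) (remaining Γ m i)

theorem remaining_nonneg {Γ : ℝ} (hΓ : 0 ≤ Γ) (m : ℕ → ℝ) (i : ℕ) : 0 ≤ remaining Γ m i := by
  cases i with
  | zero => exact hΓ
  | succ i => exact sub_nonneg.2 (min_le_right _ _)

theorem remaining_eq_zero_or {Γ : ℝ} {m : ℕ → ℝ} (hm : ∀ i, 0 ≤ m i) (n : ℕ) :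
    remaining Γ m n = 0 ∨ ∀ i < n, remaining Γ m i - remaining Γ m (i + 1) = m i := by
  induction n with
  | zero => simp
  | succ n ih =>
    rcases ih with h | h
    · left
      rw [remaining, h, min_eq_right (hm n), sub_zero]
    · rcases le_total (m n) (remaining Γ m n) with h' | h'
      · right
        intro i hi
        rcases Nat.lt_succ_iff_lt_or_eq.1 hi with hi | rfl
        · exact h i hi
        · rw [remaining, min_eq_left h']; ring
      · left
        rw [remaining, min_eq_right h', sub_self]

theorem sum_remaining (Γ : ℝ) (m : ℕ → ℝ) (n : ℕ) :
    ∑ i : Fin n, (remaining Γ m i - remaining Γ m (i + 1)) = Γ - remaining Γ m n := by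
  rw [← Finset.sum_range fun i => remaining Γ m i - remaining Γ m (i + 1),
    Finset.sum_range_sub']
  rfl

/-- Serving the items greedily is optimal for the adversary when the dual prices are fixed. -/
theorem greedy_scenario {n p k : ℕ} {x : Fin n → ℕ} (hx : ∀ i, x i = 0 ∨ x i = 1)
    {lo hi c : Fin n → ℝ} {Γ a b : ℝ} (hlohi : ∀ i, lo i ≤ hi i) (hΓ : 0 ≤ Γ) {m : ℕ → ℝ}
    (hm0 : ∀ i, 0 ≤ m i)
    (hm : ∀ i : Fin n, m i = max 0 ((if x i = 1 then a else b) - lo i) -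
      max 0 ((if x i = 1 then a else b) - hi i))
    (hc : ∀ i : Fin n, c i = lo i + (remaining Γ m i - remaining Γ m (i + 1))) :
    c ∈ budgetedScenarios lo hi Γ ∧ advDual p k x lo hi Γ a b ≤ dual p k x c a b := by
  have hδm : ∀ i, remaining Γ m i - remaining Γ m (i + 1) ≤ m i := fun i => by
    rw [remaining]; linarith [min_le_left (m i) (remaining Γ m i)]
  have hδ0 : ∀ i, 0 ≤ remaining Γ m i - remaining Γ m (i + 1) := fun i => by
    rw [remaining]; linarith [le_min (hm0 i) (remaining_nonneg hΓ m i)]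
  refine ⟨⟨fun i => remaining Γ m i - remaining Γ m (i + 1), fun i => ⟨hδ0 i, (hδm i).trans ?_⟩,
    ?_, hc⟩, ?_⟩
  · rw [hm i]
    generalize (if x i = 1 then a else b) = t
    rcases max_cases 0 (t - lo i) with ⟨h, _⟩ | ⟨h, _⟩ <;>
      linarith [le_max_left 0 (t - hi i), le_max_right 0 (t - hi i), hlohi i]
  · rw [sum_remaining]; linarith [remaining_nonneg hΓ m n]
  · rcases remaining_eq_zero_or (Γ := Γ) hm0 n with h | h
    · refine (min_le_right _ _).trans ?_
      have hs := sum_remaining Γ m n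
      rw [h] at hs
      rw [dual_eq hx, dual_eq hx]
      have : ∑ i, max 0 ((if x i = 1 then a else b) - c i) +
          ∑ i : Fin n, (remaining Γ m i - remaining Γ m (i + 1)) ≤
          ∑ i, max 0 ((if x i = 1 then a else b) - lo i) := by
        rw [← Finset.sum_add_distrib]
        refine Finset.sum_le_sum fun i _ => ?_
        have h1 := hδm i
        rw [hm i] at h1
        rw [hc i]
        generalize (if x i = 1 then a else b) = t at *
        rw [max_def 0 (t - (_ + _))]
        split_ifs <;> linarith [le_max_left 0 (t - hi i), le_max_right 0 (t - lo i)]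
      linarith
    · refine (min_le_left _ _).trans ?_
      rw [dual_eq hx, dual_eq hx]
      refine sub_le_sub_left (Finset.sum_le_sum fun i _ => max_le (le_max_left _ _) ?_) _
      rw [hc i, h i i.2, hm i]
      linarith [le_max_right 0 ((if x i = 1 then a else b) - lo i)]

/-! ### Piecewise linear concave maximisation -/

/-- The function lies above its chords. -/
def ChordLE (f : ℝ → ℝ) : Prop :=
  ∀ u u' t, 0 ≤ t → t ≤ 1 → f u + t * (f u' - f u) ≤ f (u + t * (u' - u))

theorem hinge_chordLE {n : ℕ} (μ : ℝ) (x : Fin n → ℕ) (q : ℕ) (c : Fin n → ℝ) :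
    ChordLE (hinge μ x q c) := by
  intro u u' t h0 h1
  have : (∑ i, if x i = q then max 0 (u + t * (u' - u) - c i) else 0) ≤
      (1 - t) * (∑ i, if x i = q then max 0 (u - c i) else 0) +
        t * ∑ i, if x i = q then max 0 (u' - c i) else 0 := by
    rw [Finset.mul_sum, Finset.mul_sum, ← Finset.sum_add_distrib]
    refine Finset.sum_le_sum fun i _ => ?_
    split_ifs
    · have a0 := mul_nonneg (sub_nonneg.2 h1) (le_max_left 0 (u - c i))
      have a1 := mul_nonneg h0 (le_max_left 0 (u' - c i))
      have b0 := mul_le_mul_of_nonneg_left (le_max_right 0 (u - c i)) (sub_nonneg.2 h1)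
      have b1 := mul_le_mul_of_nonneg_left (le_max_right 0 (u' - c i)) h0
      exact max_le (by linarith) (by linarith)
    · simp
  simp only [hinge]
  linarith

/-- On the interval from `u` to `u'` the function `f` is affine. -/
def AffineOn (f : ℝ → ℝ) (u u' : ℝ) : Prop :=
  ∃ α, ∀ s, u ≤ s → s ≤ u' → f s = f u + α * (s - u)

theorem hinge_affineOn {n : ℕ} (μ : ℝ) (x : Fin n → ℕ) (q : ℕ) {c : Fin n → ℝ} {u u' : ℝ}
    (h : ∀ i, c i ≤ u ∨ u' ≤ c i) : AffineOn (hinge μ x q c) u u' := by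
  have key : ∀ i, ∃ α, ∀ s, u ≤ s → s ≤ u' → (if x i = q then max 0 (s - c i) else 0) =
      (if x i = q then max 0 (u - c i) else 0) + α * (s - u) := by
    intro i
    by_cases hq : x i = q
    · simp only [hq, if_true]
      rcases h i with h | h
      · refine ⟨1, fun s hs _ => ?_⟩
        rw [max_eq_right (by linarith), max_eq_right (by linarith)]; ring
      · refine ⟨0, fun s hs hs' => ?_⟩
        rw [max_eq_left (by linarith), max_eq_left (by linarith)]; ring
    · exact ⟨0, by simp [hq]⟩
  choose α hα using key
  refine ⟨μ - ∑ i, α i, fun s hs hs' => ?_⟩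
  simp only [hinge]
  rw [Finset.sum_congr rfl fun i _ => hα i s hs hs', Finset.sum_add_distrib, ← Finset.sum_mul]
  ring

theorem AffineOn.interp {f : ℝ → ℝ} {u u' : ℝ} (h : AffineOn f u u') (hu : u ≤ u') {t : ℝ}
    (h0 : 0 ≤ t) (h1 : t ≤ 1) : f (u + t * (u' - u)) = f u + t * (f u' - f u) := by
  obtain ⟨α, h⟩ := h
  have := mul_nonneg h0 (sub_nonneg.2 hu)
  have := mul_nonneg (sub_nonneg.2 h1) (sub_nonneg.2 hu)
  rw [h u' hu le_rfl, h (u + t * (u' - u)) (by linarith) (by linarith)]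
  ring

theorem exists_interp {u u' s : ℝ} (h : u ≤ s) (h' : s ≤ u') :
    ∃ t, 0 ≤ t ∧ t ≤ 1 ∧ s = u + t * (u' - u) := by
  rcases (h.trans h').eq_or_lt with rfl | hlt
  · exact ⟨0, le_rfl, zero_le_one, by linarith⟩
  · have hpos := sub_pos.2 hlt
    refine ⟨(s - u) / (u' - u), div_nonneg (by linarith) hpos.le,
      (div_le_one hpos).2 (by linarith), ?_⟩
    rw [div_mul_cancel₀ _ hpos.ne']; ring

/-- The minimum of two affine functions on `[0, 1]` is largest at an end point or at the crossing
point. -/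
theorem min_affine_le {P₀ dP Q₀ dQ β t : ℝ} (ht0 : 0 ≤ t) (ht1 : t ≤ 1) (h0 : min P₀ Q₀ ≤ β)
    (h1 : min (P₀ + dP) (Q₀ + dQ) ≤ β)
    (hc : 0 ≤ (Q₀ - P₀) / (dP - dQ) → (Q₀ - P₀) / (dP - dQ) ≤ 1 →
      min (P₀ + (Q₀ - P₀) / (dP - dQ) * dP) (Q₀ + (Q₀ - P₀) / (dP - dQ) * dQ) ≤ β) :
    min (P₀ + t * dP) (Q₀ + t * dQ) ≤ β := by
  have ht1' := sub_nonneg.2 ht1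
  -- An affine function that is at most `β` at two points is so in between.
  have key : ∀ {F₀ dF r r' : ℝ}, r ≤ t → t ≤ r' → F₀ + r * dF ≤ β → F₀ + r' * dF ≤ β →
      F₀ + t * dF ≤ β := by
    intro F₀ dF r r' h h' hr hr'
    rcases le_total 0 dF with hd | hd
    · linarith [mul_le_mul_of_nonneg_right h' hd]
    · linarith [mul_le_mul_of_nonpos_right h hd]
  rcases le_or_gt P₀ Q₀ with h | h <;> rcases le_or_gt (P₀ + dP) (Q₀ + dQ) with h' | h'
  · rw [min_eq_left h] at h0
    rw [min_eq_left h'] at h1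
    exact (min_le_left _ _).trans (key ht0 ht1 (by linarith) (by linarith))
  · rw [min_eq_left h] at h0
    rw [min_eq_right h'.le] at h1
    have hpos : 0 < dP - dQ := by linarith
    set r := (Q₀ - P₀) / (dP - dQ) with hr
    have hr' : r * (dP - dQ) = Q₀ - P₀ := div_mul_cancel₀ _ hpos.ne'
    have := hc (div_nonneg (by linarith) hpos.le) ((div_le_one hpos).2 (by linarith))
    rw [min_eq_left (by linarith)] at this
    rcases le_total t r with htr | htr
    · exact (min_le_left _ _).trans (key ht0 htr (by linarith) this)
    · exact (min_le_right _ _).trans (key htr ht1 (by linarith) (by linarith))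
  · rw [min_eq_right h.le] at h0
    rw [min_eq_left h'] at h1
    have hneg : dP - dQ < 0 := by linarith
    set r := (Q₀ - P₀) / (dP - dQ) with hr
    have hr' : r * (dP - dQ) = Q₀ - P₀ := div_mul_cancel₀ _ hneg.ne
    have := hc (div_nonneg_of_nonpos (by linarith) hneg.le)
      ((div_le_one_of_neg hneg).2 (by linarith))
    rw [min_eq_left (by linarith)] at this
    rcases le_total t r with htr | htr
    · exact (min_le_right _ _).trans (key ht0 htr (by linarith) (by linarith))
    · exact (min_le_left _ _).trans (key htr ht1 this (by linarith))
  · rw [min_eq_right h.le] at h0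
    rw [min_eq_right h'.le] at h1
    exact (min_le_right _ _).trans (key ht0 ht1 (by linarith) (by linarith))

/-- A ray that starts in the part of a rectangle below the diagonal meets the boundary of
that part. -/
theorem exists_exit {u u' w w' a b d₁ d₂ : ℝ} (hd : d₁ ≠ 0 ∨ d₂ ≠ 0) (ha : u ≤ a) (ha' : a ≤ u')
    (hb : w ≤ b) (hb' : b ≤ w') (hab : b ≤ a) :
    ∃ τ, 0 ≤ τ ∧ (u ≤ a + τ * d₁ ∧ a + τ * d₁ ≤ u' ∧ w ≤ b + τ * d₂ ∧ b + τ * d₂ ≤ w' ∧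
      b + τ * d₂ ≤ a + τ * d₁) ∧ (a + τ * d₁ = u ∨ a + τ * d₁ = u' ∨ b + τ * d₂ = w ∨
      b + τ * d₂ = w' ∨ a + τ * d₁ = b + τ * d₂) := by
  set φ : ℝ → ℝ := fun τ => min (min (min (a + τ * d₁ - u) (u' - (a + τ * d₁)))
    (min (b + τ * d₂ - w) (w' - (b + τ * d₂)))) (a + τ * d₁ - (b + τ * d₂)) with hφ
  have hcont : Continuous φ := by fun_prop
  have h0 : 0 ≤ φ 0 := by
    simp only [hφ, zero_mul, add_zero]
    refine le_min (le_min (le_min ?_ ?_) (le_min ?_ ?_)) ?_ <;> linarith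
  have far : ∃ T, 0 ≤ T ∧ φ T ≤ 0 := by
    rcases hd with hd | hd
    · refine ⟨(u' - u) / |d₁|, div_nonneg (by linarith) (abs_nonneg _), ?_⟩
      refine (min_le_left _ _).trans ((min_le_left _ _).trans ?_)
      rcases lt_or_gt_of_ne hd with h | h
      · rw [abs_of_neg h]
        refine (min_le_left _ _).trans ?_
        rw [div_neg, neg_mul, div_mul_cancel₀ _ hd]; linarith
      · rw [abs_of_pos h]
        refine (min_le_right _ _).trans ?_
        rw [div_mul_cancel₀ _ hd]; linarith
    · refine ⟨(w' - w) / |d₂|, div_nonneg (by linarith) (abs_nonneg _), ?_⟩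
      refine (min_le_left _ _).trans ((min_le_right _ _).trans ?_)
      rcases lt_or_gt_of_ne hd with h | h
      · rw [abs_of_neg h]
        refine (min_le_left _ _).trans ?_
        rw [div_neg, neg_mul, div_mul_cancel₀ _ hd]; linarith
      · rw [abs_of_pos h]
        refine (min_le_right _ _).trans ?_
        rw [div_mul_cancel₀ _ hd]; linarith
  obtain ⟨T, hT, hφT⟩ := far
  obtain ⟨τ, hτ, hτ0⟩ := intermediate_value_Icc' hT hcont.continuousOn ⟨hφT, h0⟩
  refine ⟨τ, hτ.1, ?_, ?_⟩
  · have h : 0 ≤ φ τ := hτ0.ge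
    simp only [hφ, le_min_iff] at h
    obtain ⟨⟨⟨h1, h2⟩, h3, h4⟩, h5⟩ := h
    exact ⟨by linarith, by linarith, by linarith, by linarith, by linarith⟩
  · have h : φ τ ≤ 0 := hτ0.le
    have h' : 0 ≤ φ τ := hτ0.ge
    simp only [hφ, le_min_iff] at h'
    simp only [hφ, min_le_iff] at h
    obtain ⟨⟨⟨h1, h2⟩, h3, h4⟩, h5⟩ := h'
    rcases h with ((h | h) | h | h) | h
    · exact Or.inl (by linarith)
    · exact Or.inr (Or.inl (by linarith))
    · exact Or.inr (Or.inr (Or.inl (by linarith)))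
    · exact Or.inr (Or.inr (Or.inr (Or.inl (by linarith))))
    · exact Or.inr (Or.inr (Or.inr (Or.inr (by linarith))))

/-- Two linear forms in the plane are both nonnegative at some nonzero vector. -/
theorem exists_direction (p₁ p₂ q₁ q₂ : ℝ) :
    ∃ d₁ d₂ : ℝ, (d₁ ≠ 0 ∨ d₂ ≠ 0) ∧ 0 ≤ p₁ * d₁ + p₂ * d₂ ∧ 0 ≤ q₁ * d₁ + q₂ * d₂ := by
  by_cases hp : p₁ = 0 ∧ p₂ = 0
  · obtain ⟨rfl, rfl⟩ := hp
    rcases le_total 0 q₁ with h | h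
    · exact ⟨1, 0, by simp, by simp, by simpa⟩
    · exact ⟨-1, 0, by simp, by simp, by simpa⟩
  · have hne : p₂ ≠ 0 ∨ p₁ ≠ 0 := by tauto
    rcases le_total 0 (q₁ * p₂ - q₂ * p₁) with h | h
    · exact ⟨p₂, -p₁, by simpa using hne, by linarith, by linarith⟩
    · exact ⟨-p₂, p₁, by simpa using hne, by linarith, by linarith⟩

/-- Where all four functions are affine, `min (f₁ a + g₁ b) (f₂ a + g₂ b)` does not decrease along
a suitable ray, so it is bounded by its values at the boundary. -/
theorem exists_boundary_ge {f₁ f₂ g₁ g₂ : ℝ → ℝ} {u u' w w' a b : ℝ} (hf₁ : AffineOn f₁ u u')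
    (hf₂ : AffineOn f₂ u u') (hg₁ : AffineOn g₁ w w') (hg₂ : AffineOn g₂ w w')
    (ha : u ≤ a) (ha' : a ≤ u') (hb : w ≤ b) (hb' : b ≤ w') (hab : b ≤ a) :
    ∃ a' b', (u ≤ a' ∧ a' ≤ u' ∧ w ≤ b' ∧ b' ≤ w' ∧ b' ≤ a') ∧
      (a' = u ∨ a' = u' ∨ b' = w ∨ b' = w' ∨ a' = b') ∧
      f₁ a + g₁ b ≤ f₁ a' + g₁ b' ∧ f₂ a + g₂ b ≤ f₂ a' + g₂ b' := by
  obtain ⟨p₁, hf₁⟩ := hf₁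
  obtain ⟨q₁, hf₂⟩ := hf₂
  obtain ⟨p₂, hg₁⟩ := hg₁
  obtain ⟨q₂, hg₂⟩ := hg₂
  obtain ⟨d₁, d₂, hd, hp, hq⟩ := exists_direction p₁ p₂ q₁ q₂
  obtain ⟨τ, hτ, hreg, hbd⟩ := exists_exit hd ha ha' hb hb' hab
  refine ⟨_, _, hreg, hbd, ?_, ?_⟩
  · rw [hf₁ _ ha ha', hg₁ _ hb hb', hf₁ _ hreg.1 hreg.2.1, hg₁ _ hreg.2.2.1 hreg.2.2.2.1]
    linarith [mul_nonneg hτ hp]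
  · rw [hf₂ _ ha ha', hg₂ _ hb hb', hf₂ _ hreg.1 hreg.2.1, hg₂ _ hreg.2.2.1 hreg.2.2.2.1]
    linarith [mul_nonneg hτ hq]

/-! ### The grid of breakpoints -/

theorem AffineOn.refl (f : ℝ → ℝ) (u : ℝ) : AffineOn f u u :=
  ⟨0, fun s h h' => by rw [le_antisymm h' h]; ring⟩

theorem AffineOn.add_const {f : ℝ → ℝ} {u u' : ℝ} (h : AffineOn f u u') (r : ℝ) :
    AffineOn (fun s => f s + r) u u' := by
  obtain ⟨α, h⟩ := h
  exact ⟨α, fun s hs hs' => by simp only [h s hs hs']; ring⟩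

/-- Among the values `v 0, …, v (N - 1)`, `v s` is the least one above `v j`, or equal to
`v j` if that is the greatest. -/
def IsNext (N : ℕ) (v : ℕ → ℝ) (j s : ℕ) : Prop :=
  s < N ∧ v j ≤ v s ∧ ∀ t < N, v t ≤ v j ∨ v j < v s ∧ v s ≤ v t

/-- The number `β` is at least the linear interpolation of `min (f₁ a + g₁ b) (f₂ a + g₂ b)`
along the segment from `(u, w)` to `(u', w')`, at the end points and at the crossing point, as far
as these lie below the diagonal. -/
def EdgeBound (f₁ f₂ g₁ g₂ : ℝ → ℝ) (β u w u' w' : ℝ) : Prop :=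
  ∀ t, (t = 0 ∨ t = 1 ∨ t = (f₂ u + g₂ w - (f₁ u + g₁ w)) /
      (f₁ u' + g₁ w' - (f₁ u + g₁ w) - (f₂ u' + g₂ w' - (f₂ u + g₂ w)))) →
    0 ≤ t → t ≤ 1 → w + t * (w' - w) ≤ u + t * (u' - u) →
    min (f₁ u + g₁ w + t * (f₁ u' + g₁ w' - (f₁ u + g₁ w)))
      (f₂ u + g₂ w + t * (f₂ u' + g₂ w' - (f₂ u + g₂ w))) ≤ β

theorem EdgeBound.corner {f₁ f₂ g₁ g₂ : ℝ → ℝ} {β u w u' w' : ℝ}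
    (h : EdgeBound f₁ f₂ g₁ g₂ β u w u' w') (huw : w ≤ u) :
    min (f₁ u + g₁ w) (f₂ u + g₂ w) ≤ β := by
  simpa using h 0 (Or.inl rfl) le_rfl zero_le_one (by simpa using huw)

theorem EdgeBound.le {f₁ f₂ g₁ g₂ : ℝ → ℝ} {β u w u' w' t : ℝ}
    (h : EdgeBound f₁ f₂ g₁ g₂ β u w u' w')
    (hf₁ : AffineOn f₁ u u') (hf₂ : AffineOn f₂ u u') (hg₁ : AffineOn g₁ w w')
    (hg₂ : AffineOn g₂ w w') (hu : u ≤ u') (hw : w ≤ w') (hwu : w ≤ u) (hwu' : w' ≤ u')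
    (h0 : 0 ≤ t) (h1 : t ≤ 1) :
    min (f₁ (u + t * (u' - u)) + g₁ (w + t * (w' - w)))
      (f₂ (u + t * (u' - u)) + g₂ (w + t * (w' - w))) ≤ β := by
  have hle : ∀ t, 0 ≤ t → t ≤ 1 → w + t * (w' - w) ≤ u + t * (u' - u) := fun t h0 h1 => by
    linarith [mul_le_mul_of_nonneg_left hwu (sub_nonneg.2 h1), mul_le_mul_of_nonneg_left hwu' h0]
  rw [hf₁.interp hu h0 h1, hf₂.interp hu h0 h1, hg₁.interp hw h0 h1, hg₂.interp hw h0 h1]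
  have := min_affine_le (β := β) h0 h1 (h.corner hwu)
    (by simpa using h 1 (Or.inr (Or.inl rfl)) zero_le_one le_rfl (by linarith))
    (fun h0 h1 => h _ (Or.inr (Or.inr rfl)) h0 h1 (hle _ h0 h1))
  convert this using 2 <;> ring

/-- Bounds along the grid lines and along the diagonal bound the whole function. -/
theorem le_of_edgeBound {f₁ f₂ g₁ g₂ : ℝ → ℝ} {β : ℝ} {N : ℕ} {v : ℕ → ℝ} {σ : ℕ → ℕ}
    (hσ : ∀ j < N, IsNext N v j (σ j))
    (hf₁ : ∀ j < N, AffineOn f₁ (v j) (v (σ j))) (hf₂ : ∀ j < N, AffineOn f₂ (v j) (v (σ j)))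
    (hg₁ : ∀ j < N, AffineOn g₁ (v j) (v (σ j))) (hg₂ : ∀ j < N, AffineOn g₂ (v j) (v (σ j)))
    (hE : ∀ i < N, ∀ j < N, EdgeBound f₁ f₂ g₁ g₂ β (v i) (v j) (v i) (v (σ j)) ∧
      EdgeBound f₁ f₂ g₁ g₂ β (v i) (v j) (v (σ i)) (v j) ∧
      EdgeBound f₁ f₂ g₁ g₂ β (v i) (v j) (v (σ i)) (v (σ j)))
    {z l : ℕ} {a b : ℝ} (hz : z < N) (hl : l < N) (hzb : v z ≤ b) (hba : b ≤ a) (hal : a ≤ v l) :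
    min (f₁ a + g₁ b) (f₂ a + g₂ b) ≤ β := by
  -- The breakpoints that enclose a given number.
  have locate : ∀ s, v z ≤ s → s ≤ v l →
      ∃ i < N, v i ≤ s ∧ s ≤ v (σ i) ∧ ∀ t < N, v t ≤ s → v t ≤ v i := by
    intro s hs hs'
    obtain ⟨i, hi, hmax⟩ := Finset.exists_max_image ((Finset.range N).filter fun i => v i ≤ s) v
      ⟨z, by simp [hz, hs]⟩
    simp only [Finset.mem_filter, Finset.mem_range, and_imp] at hi hmax
    refine ⟨i, hi.1, hi.2, ?_, hmax⟩
    obtain ⟨h1, h2, h3⟩ := hσ i hi.1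
    by_contra! hlt
    have := hmax _ h1 hlt.le
    rcases h3 l hl with h | h <;> linarith
  have vert : ∀ i < N, ∀ j < N, v (σ j) ≤ v i → ∀ b, v j ≤ b → b ≤ v (σ j) →
      min (f₁ (v i) + g₁ b) (f₂ (v i) + g₂ b) ≤ β := by
    intro i hi j hj h b hb hb'
    have hs := (hσ j hj).2.1
    obtain ⟨t, h0, h1, rfl⟩ := exists_interp hb hb'
    simpa using (hE i hi j hj).1.le (.refl _ _) (.refl _ _) (hg₁ j hj) (hg₂ j hj) le_rfl hs
      (hs.trans h) h h0 h1
  have horiz : ∀ i < N, ∀ j < N, v j ≤ v i → ∀ a, v i ≤ a → a ≤ v (σ i) →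
      min (f₁ a + g₁ (v j)) (f₂ a + g₂ (v j)) ≤ β := by
    intro i hi j hj h a ha ha'
    have hs := (hσ i hi).2.1
    obtain ⟨t, h0, h1, rfl⟩ := exists_interp ha ha'
    simpa using (hE i hi j hj).2.1.le (hf₁ i hi) (hf₂ i hi) (.refl _ _) (.refl _ _) hs le_rfl h
      (h.trans hs) h0 h1
  have diag : ∀ i < N, ∀ a, v i ≤ a → a ≤ v (σ i) → min (f₁ a + g₁ a) (f₂ a + g₂ a) ≤ β := by
    intro i hi a ha ha'
    have hs := (hσ i hi).2.1
    obtain ⟨t, h0, h1, rfl⟩ := exists_interp ha ha'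
    exact (hE i hi i hi).2.2.le (hf₁ i hi) (hf₂ i hi) (hg₁ i hi) (hg₂ i hi) hs hs le_rfl le_rfl
      h0 h1
  obtain ⟨i, hi, hia, hia', himax⟩ := locate a (hzb.trans hba) hal
  have cell : ∀ j < N, v j ≤ b → b ≤ v (σ j) → j = i ∨ v (σ j) ≤ v i →
      min (f₁ a + g₁ b) (f₂ a + g₂ b) ≤ β := by
    intro j hj hjb hjb' hji
    obtain ⟨a', b', ⟨h1, h2, h3, h4, h5⟩, hbd, hle₁, hle₂⟩ := exists_boundary_ge (hf₁ i hi)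
      (hf₂ i hi) (hg₁ j hj) (hg₂ j hj) hia hia' hjb hjb' hba
    refine (min_le_min hle₁ hle₂).trans ?_
    have hs := (hσ i hi).2.1
    have hsi := (hσ i hi).1
    rcases hji with rfl | hji
    · rcases hbd with rfl | rfl | rfl | rfl | rfl
      · obtain rfl : b' = v j := le_antisymm h5 h3
        exact (hE j hj j hj).1.corner le_rfl
      · exact vert _ hsi _ hi le_rfl b' h3 h4
      · exact horiz _ hi _ hi le_rfl a' h1 h2
      · obtain rfl : a' = v (σ j) := le_antisymm h2 h5
        exact (hE _ hsi _ hsi).1.corner le_rfl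
      · exact diag _ hi a' h1 h2
    · have hsj := (hσ j hj).1
      have hs' := (hσ j hj).2.1
      rcases hbd with rfl | rfl | rfl | rfl | rfl
      · exact vert _ hi _ hj hji b' h3 h4
      · exact vert _ hsi _ hj (hji.trans hs) b' h3 h4
      · exact horiz _ hi _ hj (hs'.trans hji) a' h1 h2
      · exact horiz _ hi _ hsj hji a' h1 h2
      · obtain rfl : a' = v i := by linarith
        exact vert _ hi _ hj hji _ h3 h4
  rcases le_or_gt (v i) b with h | h
  · exact cell i hi h (hba.trans hia') (Or.inl rfl)
  · obtain ⟨j, hj, hjb, hjb', -⟩ := locate b hzb (hba.trans hal)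
    refine cell j hj hjb hjb' (Or.inr ?_)
    rcases (hσ j hj).2.2 i hi with h' | h'
    · linarith
    · exact h'.2

open RealRAM

/-! ### The program: preparation -/

/-- Adds the index variable `b` to the real variable `r`. -/
def addCount (b r : ℕ) : Cmd := .forLoop 4 b (.setReal r (.add (.var r) (.lit 1)))

theorem addCount_runs {b r m : ℕ} {s : State} (hb4 : b ≠ 4) (hb : s.idxVar b = m)
    (hr : s.realVar r = 0) :
    Runs (addCount b r) s ((m + 1) * 14) fun s' => s'.realVar r = m := by
  refine Runs.forLoop (T := 4) (fun i s' => s'.realVar r = i) hb hb4 (by simp [Cmd.idxVars])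
    (by simp [Cmd.idxVars]) (by simpa [State.setIdx] using hr) ?_
  intro i _ s' _ _ hI
  refine Runs.of_wp (by simp [Cmd.size, RealExp.cost]) ?_
  simp [Cmd.wp, RealExp.eval, State.setReal, State.setIdx, hI]

/-- The breakpoints of the dual objective: the ends of the cost intervals and `0`. -/
def breakpoint (n : ℕ) (lo hi : ℕ → ℝ) (j : ℕ) : ℝ := if j < n then lo j else hi (j - n)

/-- Stores the breakpoints in the real array 3. -/
def storeBreakpoints : Cmd :=
  .forLoop 4 0 (.seq (.writeReal 3 (.var 4) (.read 0 (.var 4)))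
    (.writeReal 3 (.add (.var 0) (.var 4)) (.read 1 (.var 4))))

theorem storeBreakpoints_runs {n : ℕ} {lo hi : ℕ → ℝ} {s : State} (hn : s.idxVar 0 = n)
    (hlo : s.realArr 0 = lo) (hhi : s.realArr 1 = hi) (h3 : s.realArr 3 = 0)
    (hhi0 : ∀ i, n ≤ i → hi i = 0) :
    Runs storeBreakpoints s ((n + 1) * 20) fun s' => s'.realArr 3 = breakpoint n lo hi := by
  refine (Runs.forLoop (T := 10) (fun i s' => ∀ j, s'.realArr 3 j =
    if j < i then lo j else if n ≤ j ∧ j < n + i then hi (j - n) else 0) hn (by decide)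
    (by decide) (by decide) ?_ ?_).imp le_rfl ?_
  · intro j
    simp [State.setIdx, h3]
  · intro i hi s' hf hvi hI
    have e0 := hf.realArr 0 (by decide)
    have e1 := hf.realArr 1 (by decide)
    have en := hf.idxVar 0 (by decide)
    refine Runs.of_wp (by decide) ?_
    simp only [Cmd.wp, RealExp.eval, IdxExp.eval, State.setIdx, State.writeReal, hvi, e0, e1, en,
      hlo, hhi, hn, Function.update_apply, hI, if_true]
    intro j
    rcases eq_or_ne j (n + i) with rfl | h1
    · simp; omega
    · rcases eq_or_ne j i with rfl | h2
      · simp; omega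
      · have e1 : j < i + 1 ↔ j < i := by omega
        have e2 : j < n + (i + 1) ↔ j < n + i := by omega
        simp [h1, h2, e1, e2]
  · intro s' _ hI
    funext j
    rw [hI j, breakpoint]
    split_ifs with h1 h2
    · rfl
    · rfl
    · rw [hhi0]; omega

theorem toArray_apply {α : Type} [Zero α] {n : ℕ} (v : Fin n → α) (i : Fin n) :
    toArray v i = v i := by simp [toArray]

theorem toArray_of_le {α : Type} [Zero α] {n : ℕ} (v : Fin n → α) {i : ℕ} (h : n ≤ i) :
    toArray v i = 0 := by simp [toArray, Nat.not_lt.2 h]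

theorem hinge_eq_range {n : ℕ} (μ : ℝ) (x : Fin n → ℕ) (q : ℕ) (c : Fin n → ℝ) (t : ℝ) :
    hinge μ x q c t = μ * t -
      ∑ i ∈ Finset.range n, if toArray x i = q then max 0 (t - toArray c i) else 0 := by
  rw [hinge, Finset.sum_range]
  simp only [toArray_apply]

/-- Tabulates in the real array `d` the function `hinge`, at the points stored in the real array 3;
the slope is in the real variable `r` and the kinks are in the real array `src`. -/
def tabulate (src q r d : ℕ) : Cmd :=
  .forLoop 4 3 (.seq (.setReal 3 (.mul (.var r) (.read 3 (.var 4)))) (.seq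
    (.forLoop 5 0 (.ite (.conj (.conj (.idxLe (.read 0 (.var 5)) (.lit q))
        (.idxLe (.lit q) (.read 0 (.var 5)))) (.realLe (.read src (.var 5)) (.read 3 (.var 4))))
      (.setReal 3 (.sub (.var 3) (.sub (.read 3 (.var 4)) (.read src (.var 5))))) .skip))
    (.writeReal d (.var 4) (.var 3))))

theorem tabulate_runs {src q r d n N : ℕ} {x : Fin n → ℕ} {c : Fin n → ℝ} {μ : ℝ} {v : ℕ → ℝ}
    {s : State} (hr3 : r ≠ 3) (hd3 : d ≠ 3) (hsd : src ≠ d) (hn : s.idxVar 0 = n)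
    (hN : s.idxVar 3 = N) (hx : s.idxArr 0 = toArray x) (hc : s.realArr src = toArray c)
    (hr : s.realVar r = μ) (hv : s.realArr 3 = v) :
    Runs (tabulate src q r d) s ((N + 1) * (9 + (n + 1) * 40 + 10)) fun s' =>
      ∀ j < N, s'.realArr d j = hinge μ x q c (v j) := by
  refine Runs.forLoop (T := 9 + (n + 1) * 40)
    (fun i s' => ∀ j < i, s'.realArr d j = hinge μ x q c (v j)) hN (by decide)
    (by simp [Cmd.idxVars, Cmd.forLoop]) (by simp [Cmd.idxVars, Cmd.forLoop]) (by simp) ?_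
  intro i hi s₁ hf hvi hI
  have en := hf.idxVar 0 (by simp [Cmd.forLoop, Cmd.idxVars])
  have ex := hf.idxArr 0 (by simp [Cmd.forLoop, Cmd.idxArrs])
  have ec := hf.realArr src (by simpa [Cmd.forLoop, Cmd.realArrs] using hsd)
  have er := hf.realVar r (by simpa [Cmd.forLoop, Cmd.realVars] using hr3)
  have ev := hf.realArr 3 (by simpa [Cmd.forLoop, Cmd.realArrs] using hd3.symm)
  rw [hn] at en; rw [hx] at ex; rw [hc] at ec; rw [hr] at er; rw [hv] at ev
  refine Runs.imp (T := 5 + ((n + 1) * (30 + 10) + 3)) (Runs.seq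
    (R := fun s' => s'.realVar 3 = μ * v i)
    (Runs.of_wp (by simp [Cmd.size, RealExp.cost, IdxExp.cost])
      (by simp [Cmd.wp, RealExp.eval, IdxExp.eval, State.setReal, er, ev, hvi])) ?_) (by omega)
    fun _ _ h => h
  intro s₂ hf₂ hacc
  have fv : s₂.idxVar 4 = i := by rw [hf₂.idxVar 4 (by simp [Cmd.idxVars]), hvi]
  have fn : s₂.idxVar 0 = n := by rw [hf₂.idxVar 0 (by simp [Cmd.idxVars]), en]
  have fx : s₂.idxArr 0 = toArray x := by rw [hf₂.idxArr 0 (by simp [Cmd.idxArrs]), ex]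
  have fc : s₂.realArr src = toArray c := by rw [hf₂.realArr src (by simp [Cmd.realArrs]), ec]
  have fa : s₂.realArr 3 = v := by rw [hf₂.realArr 3 (by simp [Cmd.realArrs]), ev]
  have fd : s₂.realArr d = s₁.realArr d := hf₂.realArr d (by simp [Cmd.realArrs])
  refine Runs.seq (Runs.forLoop (fun l s' => s'.realVar 3 = μ * v i -
    ∑ i' ∈ Finset.range l, if toArray x i' = q then max 0 (v i - toArray c i') else 0) fn
    (by decide) (by simp [Cmd.idxVars]) (by simp [Cmd.idxVars]) (by simpa [State.setIdx]) ?_) ?_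
  · intro l hl s₃ hf₃ hvl hI₃
    have gv := hf₃.idxVar 4 (by simp [Cmd.forLoop, Cmd.idxVars])
    have gx := hf₃.idxArr 0 (by simp [Cmd.forLoop, Cmd.idxArrs])
    have gc := hf₃.realArr src (by simp [Cmd.forLoop, Cmd.realArrs])
    have ga := hf₃.realArr 3 (by simp [Cmd.forLoop, Cmd.realArrs])
    rw [fv] at gv; rw [fx] at gx; rw [fc] at gc; rw [fa] at ga
    refine Runs.of_wp (by simp [Cmd.size, RealExp.cost, IdxExp.cost, Test.cost]) ?_
    simp only [Cmd.wp, RealExp.eval, IdxExp.eval, Test.holds, State.setReal, State.setIdx, gv, gx,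
      gc, ga, hvl, hI₃, Finset.sum_range_succ, Function.update_self]
    constructor
    · rintro ⟨⟨h1, h2⟩, h3⟩
      rw [if_pos (le_antisymm h1 h2), max_eq_right (sub_nonneg.2 h3)]; ring
    · intro h
      by_cases hq : toArray x l = q
      · have : ¬ toArray c l ≤ v i := fun h' => h ⟨⟨hq.le, hq.ge⟩, h'⟩
        rw [if_pos hq, max_eq_left (by linarith)]; ring
      · rw [if_neg hq]; ring
  · intro s₃ hf₃ hI₃
    have gv := hf₃.idxVar 4 (by simp [Cmd.forLoop, Cmd.idxVars])
    have gd := hf₃.realArr d (by simp [Cmd.forLoop, Cmd.realArrs])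
    rw [fv] at gv; rw [fd] at gd
    refine Runs.of_wp (by simp [Cmd.size, RealExp.cost, IdxExp.cost]) ?_
    simp only [Cmd.wp, RealExp.eval, IdxExp.eval, State.writeReal, State.setIdx, gv, hI₃, gd,
      Function.update_self]
    intro j hj
    rcases Nat.lt_succ_iff_lt_or_eq.1 hj with hj | rfl
    · rw [Function.update_of_ne hj.ne, hI j hj]
    · rw [Function.update_self, hinge_eq_range]

/-- Stores in the index array 1, for each breakpoint, the index of the next greater one. -/
def storeNext : Cmd :=
  .forLoop 4 3 (.seq (.setIdx 6 (.var 4)) (.seq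
    (.forLoop 5 3 (.ite (.conj (.neg (.realLe (.read 3 (.var 5)) (.read 3 (.var 4))))
        (.neg (.conj (.neg (.realLe (.read 3 (.var 6)) (.read 3 (.var 4))))
          (.neg (.realLe (.read 3 (.var 5)) (.read 3 (.var 6)))))))
      (.setIdx 6 (.var 5)) .skip))
    (.writeIdx 1 (.var 4) (.var 6))))

theorem storeNext_runs {N : ℕ} {v : ℕ → ℝ} {s : State} (hN : s.idxVar 3 = N)
    (hv : s.realArr 3 = v) :
    Runs storeNext s ((N + 1) * (5 + (N + 1) * 40 + 10)) fun s' =>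
      ∀ j < N, IsNext N v j (s'.idxArr 1 j) := by
  refine Runs.forLoop (T := 5 + (N + 1) * 40)
    (fun i s' => ∀ j < i, IsNext N v j (s'.idxArr 1 j)) hN (by decide)
    (by decide) (by decide) (by simp) ?_
  intro i hi s₁ hf hvi hI
  have eN := hf.idxVar 3 (by decide)
  have ev := hf.realArr 3 (by decide)
  rw [hN] at eN; rw [hv] at ev
  refine Runs.imp (T := 2 + ((N + 1) * (30 + 10) + 3)) (Runs.seq
    (R := fun s' => s'.idxVar 6 = i) (Runs.of_wp (by decide)
      (by simp [Cmd.wp, IdxExp.eval, State.setIdx, hvi])) ?_) (by omega) fun _ _ h => h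
  intro s₂ hf₂ h6
  have fv : s₂.idxVar 4 = i := by rw [hf₂.idxVar 4 (by decide), hvi]
  have fN : s₂.idxVar 3 = N := by rw [hf₂.idxVar 3 (by decide), eN]
  have fa : s₂.realArr 3 = v := by rw [hf₂.realArr 3 (by decide), ev]
  have fd : s₂.idxArr 1 = s₁.idxArr 1 := hf₂.idxArr 1 (by decide)
  refine Runs.seq (Runs.forLoop (fun l s' => s'.idxVar 6 < N ∧ v i ≤ v (s'.idxVar 6) ∧
    ∀ t < l, v t ≤ v i ∨ v i < v (s'.idxVar 6) ∧ v (s'.idxVar 6) ≤ v t) fN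
    (by decide) (by decide) (by decide) (by simp [State.setIdx, h6, hi]) ?_) ?_
  · intro l hl s₃ hf₃ hvl hI₃
    have gv := hf₃.idxVar 4 (by decide)
    have ga := hf₃.realArr 3 (by decide)
    rw [fv] at gv; rw [fa] at ga
    refine Runs.of_wp (by decide) ?_
    simp only [Cmd.wp, RealExp.eval, IdxExp.eval, Test.holds, State.setIdx, gv, ga, hvl,
      Function.update_apply]
    generalize s₃.idxVar 6 = σ at *
    obtain ⟨h1, h2, h3⟩ := hI₃
    simp only [not_le, not_and, not_lt] at *
    constructor
    · rintro ⟨h4, h5⟩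
      refine ⟨by simpa, by simpa using h4.le, fun t ht => ?_⟩
      simp only [show (6 : ℕ) ≠ 5 by decide, ↓reduceIte]
      rcases Nat.lt_succ_iff_lt_or_eq.1 ht with ht | rfl
      · exact (h3 t ht).imp id fun h => ⟨h4, (h5 h.1).trans h.2⟩
      · exact Or.inr ⟨h4, le_rfl⟩
    · intro h4
      refine ⟨by simpa, by simpa, fun t ht => ?_⟩
      simp only [show (6 : ℕ) ≠ 5 by decide, ↓reduceIte]
      rcases Nat.lt_succ_iff_lt_or_eq.1 ht with ht | rfl
      · exact h3 t ht
      · rcases le_or_gt (v t) (v i) with h | h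
        · exact Or.inl h
        · have := h4 h
          push Not at this
          exact Or.inr ⟨this.1, this.2.le⟩
  · intro s₃ hf₃ hI₃
    have gv := hf₃.idxVar 4 (by decide)
    have gd := hf₃.idxArr 1 (by decide)
    rw [fv] at gv; rw [fd] at gd
    refine Runs.of_wp (by decide) ?_
    simp only [Cmd.wp, IdxExp.eval, State.writeIdx, State.setIdx, gv, gd, Function.update_self]
    intro j hj
    rcases Nat.lt_succ_iff_lt_or_eq.1 hj with hj | rfl
    · rw [Function.update_of_ne hj.ne]; exact hI j hj
    · rw [Function.update_self]; exact hI₃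

/-! ### The program: search -/

/-- The prices `a` and `b` are feasible, and their dual objective is at least `β`. -/
def Attained (f₁ f₂ g₁ g₂ : ℝ → ℝ) (β a b : ℝ) : Prop :=
  b ≤ a ∧ β ≤ f₁ a + g₁ b ∧ β ≤ f₂ a + g₂ b

/-- The incumbent value is in the real variable 4, its prices are in the real variables 5 and 6. -/
def Incumbent (f₁ f₂ g₁ g₂ : ℝ → ℝ) (s : State) : Prop :=
  Attained f₁ f₂ g₁ g₂ (s.realVar 4) (s.realVar 5) (s.realVar 6)

/-- Compares the incumbent with the interpolation at the parameter `e` along the current segment.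
The real variables 8, 10, 12 and 14 hold the two values of the objective and the prices `a` and `b`
at its start, and the real variables 9, 11, 13 and 15 their increments along it. -/
def tryPoint (e : RealExp) : Cmd :=
  .seq (.setReal 7 e) (.seq
    (.setReal 16 (.add (.var 8) (.mul (.var 7) (.var 9)))) (.seq
    (.setReal 17 (.add (.var 10) (.mul (.var 7) (.var 11)))) (.seq
    (.setReal 18 (.add (.var 12) (.mul (.var 7) (.var 13)))) (.seq
    (.setReal 19 (.add (.var 14) (.mul (.var 7) (.var 15)))) (.seq
    (.ite (.realLe (.var 16) (.var 17)) .skip (.setReal 16 (.var 17)))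
    (.ite (.conj (.realLe (.lit 0) (.var 7)) (.conj (.realLe (.var 7) (.lit 1))
        (.conj (.realLe (.var 19) (.var 18)) (.realLe (.var 4) (.var 16)))))
      (.seq (.setReal 4 (.var 16)) (.seq (.setReal 5 (.var 18)) (.setReal 6 (.var 19))))
      .skip))))))

theorem tryPoint_runs {f₁ f₂ g₁ g₂ : ℝ → ℝ} {P₀ dP Q₀ dQ u du w dw t : ℝ} {e : RealExp} {s : State}
    (he : e.eval s = t) (hcost : e.cost ≤ 10) (h8 : s.realVar 8 = P₀) (h9 : s.realVar 9 = dP)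
    (h10 : s.realVar 10 = Q₀) (h11 : s.realVar 11 = dQ) (h12 : s.realVar 12 = u)
    (h13 : s.realVar 13 = du) (h14 : s.realVar 14 = w) (h15 : s.realVar 15 = dw)
    (hI : Incumbent f₁ f₂ g₁ g₂ s)
    (hP : 0 ≤ t → t ≤ 1 → P₀ + t * dP ≤ f₁ (u + t * du) + g₁ (w + t * dw))
    (hQ : 0 ≤ t → t ≤ 1 → Q₀ + t * dQ ≤ f₂ (u + t * du) + g₂ (w + t * dw)) :
    Runs (tryPoint e) s 80 fun s' => Incumbent f₁ f₂ g₁ g₂ s' ∧ s.realVar 4 ≤ s'.realVar 4 ∧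
      (0 ≤ t → t ≤ 1 → w + t * dw ≤ u + t * du →
        min (P₀ + t * dP) (Q₀ + t * dQ) ≤ s'.realVar 4) := by
  refine Runs.of_wp (by simp [tryPoint, Cmd.size, RealExp.cost, Test.cost]; omega) ?_
  simp [tryPoint, Incumbent, Cmd.wp, RealExp.eval, Test.holds, State.setReal, he, h8, h9, h10, h11,
    h12, h13, h14, h15] at hI ⊢
  refine ⟨fun h => ⟨fun h0 h1 h2 h3 => ⟨⟨h2, hP h0 h1, h.trans (hQ h0 h1)⟩, h3⟩,
    fun h' => ⟨hI, fun h0 h1 h2 => Or.inl (h' h0 h1 h2).le⟩⟩,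
    fun h => ⟨fun h0 h1 h2 h3 => ⟨⟨h2, h.le.trans (hP h0 h1), hQ h0 h1⟩, h3⟩,
    fun h' => ⟨hI, fun h0 h1 h2 => Or.inr (h' h0 h1 h2).le⟩⟩⟩

/-- The real array 3 holds the breakpoints, and the real arrays 4 to 7 hold the values of the four
summands of the dual objective there, the budget in the real variable 0 being left out. -/
structure Tables (N : ℕ) (v : ℕ → ℝ) (f₁ f₂ g₁ g₂ : ℝ → ℝ) (s : State) : Prop where
  points : s.realArr 3 = v
  f₁ : ∀ j < N, s.realArr 4 j = f₁ (v j)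
  f₂ : ∀ j < N, s.realArr 5 j = f₂ (v j)
  g₁ : ∀ j < N, s.realArr 6 j = g₁ (v j)
  g₂ : ∀ j < N, s.realArr 7 j + s.realVar 0 = g₂ (v j)

theorem Tables.of_frame {N : ℕ} {v : ℕ → ℝ} {f₁ f₂ g₁ g₂ : ℝ → ℝ} {s s' : State} {P : Cmd}
    (h : Tables N v f₁ f₂ g₁ g₂ s) (hf : Frame P s s') (hP : P.realArrs = [])
    (h0 : 0 ∉ P.realVars) : Tables N v f₁ f₂ g₁ g₂ s' := by
  have e : ∀ a, s'.realArr a = s.realArr a := fun a => hf.realArr a (by simp [hP])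
  exact ⟨by rw [e, h.points], by simpa only [e] using h.f₁, by simpa only [e] using h.f₂,
    by simpa only [e] using h.g₁, by simpa only [e, hf.realVar 0 h0] using h.g₂⟩

/-- Compares the incumbent with the candidates on the segment from the grid point given by the
index variables 4 and 5 to that given by the index variables 6 and 7. -/
def tryEdge : Cmd :=
  .seq (.seq
    (.setReal 8 (.add (.read 4 (.var 4)) (.read 6 (.var 5)))) (.seq
    (.setReal 9 (.sub (.add (.read 4 (.var 6)) (.read 6 (.var 7))) (.var 8))) (.seq
    (.setReal 10 (.add (.read 5 (.var 4)) (.add (.read 7 (.var 5)) (.var 0)))) (.seq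
    (.setReal 11 (.sub (.add (.read 5 (.var 6)) (.add (.read 7 (.var 7)) (.var 0)))
      (.var 10))) (.seq
    (.setReal 12 (.read 3 (.var 4))) (.seq
    (.setReal 13 (.sub (.read 3 (.var 6)) (.var 12))) (.seq
    (.setReal 14 (.read 3 (.var 5)))
    (.setReal 15 (.sub (.read 3 (.var 7)) (.var 14))))))))))
  (.seq (tryPoint (.lit 0)) (.seq (tryPoint (.lit 1))
    (tryPoint (.div (.sub (.var 10) (.var 8)) (.sub (.var 9) (.var 11))))))

theorem tryEdge_runs {N : ℕ} {v : ℕ → ℝ} {f₁ f₂ g₁ g₂ : ℝ → ℝ} (hf₁ : ChordLE f₁) (hf₂ : ChordLE f₂)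
    (hg₁ : ChordLE g₁) (hg₂ : ChordLE g₂) {s : State} (hT : Tables N v f₁ f₂ g₁ g₂ s)
    (hI : Incumbent f₁ f₂ g₁ g₂ s) {i j i' j' : ℕ} (h4 : s.idxVar 4 = i) (h5 : s.idxVar 5 = j)
    (h6 : s.idxVar 6 = i') (h7 : s.idxVar 7 = j') (hi : i < N) (hj : j < N) (hi' : i' < N)
    (hj' : j' < N) :
    Runs tryEdge s 320 fun s' => Incumbent f₁ f₂ g₁ g₂ s' ∧ s.realVar 4 ≤ s'.realVar 4 ∧
      EdgeBound f₁ f₂ g₁ g₂ (s'.realVar 4) (v i) (v j) (v i') (v j') := by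
  refine Runs.imp (T := 60 + (80 + (80 + 80))) (Runs.seq (R := fun s' =>
    s'.realVar 8 = f₁ (v i) + g₁ (v j) ∧
    s'.realVar 9 = f₁ (v i') + g₁ (v j') - (f₁ (v i) + g₁ (v j)) ∧
    s'.realVar 10 = f₂ (v i) + g₂ (v j) ∧
    s'.realVar 11 = f₂ (v i') + g₂ (v j') - (f₂ (v i) + g₂ (v j)) ∧
    s'.realVar 12 = v i ∧ s'.realVar 13 = v i' - v i ∧ s'.realVar 14 = v j ∧
    s'.realVar 15 = v j' - v j ∧ Incumbent f₁ f₂ g₁ g₂ s' ∧ s'.realVar 4 = s.realVar 4)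
    (Runs.of_wp (by decide) ?_) ?_) (by norm_num) fun _ _ h => h
  · simpa [Incumbent, Cmd.wp, RealExp.eval, IdxExp.eval, State.setReal, h4, h5, h6, h7, hT.points,
      hT.f₁ i hi, hT.f₂ i hi, hT.g₁ j hj, hT.g₂ j hj, hT.f₁ i' hi', hT.f₂ i' hi', hT.g₁ j' hj',
      hT.g₂ j' hj'] using hI
  rintro s₁ - ⟨h8, h9, h10, h11, h12, h13, h14, h15, hI₁, hβ⟩
  have hP : ∀ t, 0 ≤ t → t ≤ 1 →
      f₁ (v i) + g₁ (v j) + t * (f₁ (v i') + g₁ (v j') - (f₁ (v i) + g₁ (v j))) ≤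
        f₁ (v i + t * (v i' - v i)) + g₁ (v j + t * (v j' - v j)) := fun t h0 h1 => by
    linarith [hf₁ (v i) (v i') t h0 h1, hg₁ (v j) (v j') t h0 h1]
  have hQ : ∀ t, 0 ≤ t → t ≤ 1 →
      f₂ (v i) + g₂ (v j) + t * (f₂ (v i') + g₂ (v j') - (f₂ (v i) + g₂ (v j))) ≤
        f₂ (v i + t * (v i' - v i)) + g₂ (v j + t * (v j' - v j)) := fun t h0 h1 => by
    linarith [hf₂ (v i) (v i') t h0 h1, hg₂ (v j) (v j') t h0 h1]
  refine Runs.seq (tryPoint_runs rfl (by decide) h8 h9 h10 h11 h12 h13 h14 h15 hI₁ (hP _) (hQ _)) ?_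
  rintro s₂ hf ⟨hI₂, hβ₂, hE₂⟩
  rw [← hf.realVar 8 (by decide)] at h8; rw [← hf.realVar 9 (by decide)] at h9
  rw [← hf.realVar 10 (by decide)] at h10; rw [← hf.realVar 11 (by decide)] at h11
  rw [← hf.realVar 12 (by decide)] at h12; rw [← hf.realVar 13 (by decide)] at h13
  rw [← hf.realVar 14 (by decide)] at h14; rw [← hf.realVar 15 (by decide)] at h15
  refine Runs.seq (tryPoint_runs rfl (by decide) h8 h9 h10 h11 h12 h13 h14 h15 hI₂ (hP _) (hQ _)) ?_
  rintro s₃ hf ⟨hI₃, hβ₃, hE₃⟩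
  rw [← hf.realVar 8 (by decide)] at h8; rw [← hf.realVar 9 (by decide)] at h9
  rw [← hf.realVar 10 (by decide)] at h10; rw [← hf.realVar 11 (by decide)] at h11
  rw [← hf.realVar 12 (by decide)] at h12; rw [← hf.realVar 13 (by decide)] at h13
  rw [← hf.realVar 14 (by decide)] at h14; rw [← hf.realVar 15 (by decide)] at h15
  refine (tryPoint_runs rfl (by decide) h8 h9 h10 h11 h12 h13 h14 h15 hI₃ (hP _)
    (hQ _)).imp le_rfl ?_
  rintro s₄ - ⟨hI₄, hβ₄, hE₄⟩
  refine ⟨hI₄, by linarith, ?_⟩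
  simp only [RealExp.eval, h8, h9, h10, h11, Nat.cast_zero, Nat.cast_one] at hE₂ hE₃ hE₄
  rintro t (rfl | rfl | rfl) h0 h1 h
  · exact (hE₂ h0 h1 h).trans (by linarith)
  · exact (hE₃ h0 h1 h).trans hβ₄
  · exact hE₄ h0 h1 h

/-- The bounds along the three segments that belong to the grid point `(i, j)`. -/
def CellBound (v : ℕ → ℝ) (σ : ℕ → ℕ) (f₁ f₂ g₁ g₂ : ℝ → ℝ) (β : ℝ) (i j : ℕ) : Prop :=
  EdgeBound f₁ f₂ g₁ g₂ β (v i) (v j) (v i) (v (σ j)) ∧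
    EdgeBound f₁ f₂ g₁ g₂ β (v i) (v j) (v (σ i)) (v j) ∧
    EdgeBound f₁ f₂ g₁ g₂ β (v i) (v j) (v (σ i)) (v (σ j))

theorem EdgeBound.mono {f₁ f₂ g₁ g₂ : ℝ → ℝ} {β β' u w u' w' : ℝ}
    (h : EdgeBound f₁ f₂ g₁ g₂ β u w u' w') (hβ : β ≤ β') : EdgeBound f₁ f₂ g₁ g₂ β' u w u' w' :=
  fun t ht h0 h1 h' => (h t ht h0 h1 h').trans hβ

theorem CellBound.mono {v : ℕ → ℝ} {σ : ℕ → ℕ} {f₁ f₂ g₁ g₂ : ℝ → ℝ} {β β' : ℝ} {i j : ℕ}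
    (h : CellBound v σ f₁ f₂ g₁ g₂ β i j) (hβ : β ≤ β') : CellBound v σ f₁ f₂ g₁ g₂ β' i j :=
  ⟨h.1.mono hβ, h.2.1.mono hβ, h.2.2.mono hβ⟩

/-- Searches the segments that belong to the grid point given by the index variables 4 and 5. -/
def tryCell : Cmd :=
  .seq (.seq (.setIdx 6 (.var 4)) (.setIdx 7 (.read 1 (.var 5)))) (.seq tryEdge (.seq
    (.seq (.setIdx 6 (.read 1 (.var 4))) (.setIdx 7 (.var 5))) (.seq tryEdge (.seq
    (.setIdx 7 (.read 1 (.var 5))) tryEdge))))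

theorem tryCell_runs {N : ℕ} {v : ℕ → ℝ} {f₁ f₂ g₁ g₂ : ℝ → ℝ} (hf₁ : ChordLE f₁) (hf₂ : ChordLE f₂)
    (hg₁ : ChordLE g₁) (hg₂ : ChordLE g₂) {s : State} (hT : Tables N v f₁ f₂ g₁ g₂ s)
    (hI : Incumbent f₁ f₂ g₁ g₂ s) {i j : ℕ} {σ : ℕ → ℕ} (h4 : s.idxVar 4 = i) (h5 : s.idxVar 5 = j)
    (h1 : s.idxArr 1 = σ) (hi : i < N) (hj : j < N) (hσ : ∀ j < N, σ j < N) :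
    Runs tryCell s 1000 fun s' => Incumbent f₁ f₂ g₁ g₂ s' ∧ s.realVar 4 ≤ s'.realVar 4 ∧
      CellBound v σ f₁ f₂ g₁ g₂ (s'.realVar 4) i j := by
  refine Runs.imp (T := 10 + (320 + (10 + (320 + (10 + 320))))) (Runs.seq
    (R := fun s' => s'.idxVar 6 = i ∧ s'.idxVar 7 = σ j) (Runs.of_wp (by decide)
    (by simp [Cmd.wp, IdxExp.eval, State.setIdx, h4, h5, h1])) ?_) (by norm_num) fun _ _ h => h
  rintro s₁ hf ⟨h6, h7⟩
  rw [← hf.idxVar 4 (by decide)] at h4; rw [← hf.idxVar 5 (by decide)] at h5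
  rw [← hf.idxArr 1 (by decide)] at h1
  rw [Incumbent, ← hf.realVar 4 (by decide), ← hf.realVar 5 (by decide),
    ← hf.realVar 6 (by decide)] at hI
  rw [← hf.realVar 4 (by decide)]
  replace hT := hT.of_frame hf rfl (by decide)
  refine Runs.seq (tryEdge_runs hf₁ hf₂ hg₁ hg₂ hT hI h4 h5 h6 h7 hi hj hi (hσ j hj)) ?_
  clear hf
  rintro s₂ hf ⟨hI₂, hβ₂, hE₂⟩
  rw [← hf.idxVar 4 (by decide)] at h4; rw [← hf.idxVar 5 (by decide)] at h5
  rw [← hf.idxArr 1 (by decide)] at h1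
  replace hT := hT.of_frame hf rfl (by decide)
  refine Runs.seq (R := fun s' => s'.idxVar 6 = σ i ∧ s'.idxVar 7 = j) (Runs.of_wp (by decide)
    (by simp [Cmd.wp, IdxExp.eval, State.setIdx, h4, h5, h1])) ?_
  clear hf h6 h7
  rintro s₃ hf ⟨h6, h7⟩
  rw [← hf.idxVar 4 (by decide)] at h4; rw [← hf.idxVar 5 (by decide)] at h5
  rw [← hf.idxArr 1 (by decide)] at h1
  rw [Incumbent, ← hf.realVar 4 (by decide), ← hf.realVar 5 (by decide),
    ← hf.realVar 6 (by decide)] at hI₂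
  rw [← hf.realVar 4 (by decide)] at hE₂ hβ₂
  replace hT := hT.of_frame hf rfl (by decide)
  refine Runs.seq (tryEdge_runs hf₁ hf₂ hg₁ hg₂ hT hI₂ h4 h5 h6 h7 hi hj (hσ i hi) hj) ?_
  clear hf
  rintro s₄ hf ⟨hI₄, hβ₄, hE₄⟩
  rw [← hf.idxVar 4 (by decide)] at h4; rw [← hf.idxVar 5 (by decide)] at h5
  rw [← hf.idxArr 1 (by decide)] at h1
  rw [← hf.idxVar 6 (by decide)] at h6
  replace hT := hT.of_frame hf rfl (by decide)
  refine Runs.seq (R := fun s' => s'.idxVar 7 = σ j) (Runs.of_wp (by decide)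
    (by simp [Cmd.wp, IdxExp.eval, State.setIdx, h5, h1])) ?_
  clear hf h7
  rintro s₅ hf h7
  rw [← hf.idxVar 4 (by decide)] at h4; rw [← hf.idxVar 5 (by decide)] at h5
  rw [← hf.idxVar 6 (by decide)] at h6
  rw [Incumbent, ← hf.realVar 4 (by decide), ← hf.realVar 5 (by decide),
    ← hf.realVar 6 (by decide)] at hI₄
  rw [← hf.realVar 4 (by decide)] at hE₄ hβ₄
  replace hT := hT.of_frame hf rfl (by decide)
  refine (tryEdge_runs hf₁ hf₂ hg₁ hg₂ hT hI₄ h4 h5 h6 h7 hi hj (hσ i hi) (hσ j hj)).imp le_rfl ?_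
  rintro s₆ - ⟨hI₆, hβ₆, hE₆⟩
  exact ⟨hI₆, by linarith, hE₂.mono (by linarith), hE₄.mono hβ₆, hE₆⟩

/-- Searches all grid lines and the diagonal. -/
def searchGrid : Cmd := .forLoop 4 3 (.forLoop 5 3 tryCell)

theorem searchGrid_runs {N : ℕ} {v : ℕ → ℝ} {f₁ f₂ g₁ g₂ : ℝ → ℝ} (hf₁ : ChordLE f₁)
    (hf₂ : ChordLE f₂) (hg₁ : ChordLE g₁) (hg₂ : ChordLE g₂) {s : State}
    (hT : Tables N v f₁ f₂ g₁ g₂ s) (hI : Incumbent f₁ f₂ g₁ g₂ s) {σ : ℕ → ℕ}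
    (hN : s.idxVar 3 = N) (h1 : s.idxArr 1 = σ) (hσ : ∀ j < N, σ j < N) :
    Runs searchGrid s ((N + 1) * ((N + 1) * 1010 + 10)) fun s' => Incumbent f₁ f₂ g₁ g₂ s' ∧
      ∀ i < N, ∀ j < N, CellBound v σ f₁ f₂ g₁ g₂ (s'.realVar 4) i j := by
  refine Runs.forLoop (fun m s' => Incumbent f₁ f₂ g₁ g₂ s' ∧
    ∀ i < m, ∀ j < N, CellBound v σ f₁ f₂ g₁ g₂ (s'.realVar 4) i j) hN (by decide) (by decide)
    (by decide) ⟨hI, by simp⟩ ?_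
  rintro i hi s₁ hf h4 ⟨hI₁, hE₁⟩
  have hT₁ := hT.of_frame hf rfl (by decide)
  rw [← hf.idxVar 3 (by decide)] at hN
  rw [← hf.idxArr 1 (by decide)] at h1
  refine (Runs.forLoop (fun m s' => Incumbent f₁ f₂ g₁ g₂ s' ∧ s₁.realVar 4 ≤ s'.realVar 4 ∧
    ∀ j < m, CellBound v σ f₁ f₂ g₁ g₂ (s'.realVar 4) i j) hN (by decide) (by decide)
    (by decide) ⟨hI₁, le_rfl, by simp⟩ ?_).imp (T := (N + 1) * (1000 + 10)) le_rfl ?_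
  · rintro j hj s₂ hf' h5 ⟨hI₂, hβ₂, hE₂⟩
    have hT₂ := hT₁.of_frame hf' rfl (by decide)
    rw [← hf'.idxVar 4 (by decide)] at h4
    rw [← hf'.idxArr 1 (by decide)] at h1
    refine (tryCell_runs hf₁ hf₂ hg₁ hg₂ hT₂ hI₂ h4 h5 h1 hi hj hσ).imp le_rfl ?_
    rintro s₃ - ⟨hI₃, hβ₃, hE₃⟩
    refine ⟨hI₃, hβ₂.trans hβ₃, fun j' hj' => ?_⟩
    rcases Nat.lt_succ_iff_lt_or_eq.1 hj' with hj' | rfl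
    · exact (hE₂ j' hj').mono hβ₃
    · exact hE₃
  · rintro s₂ - ⟨hI₂, hβ₂, hE₂⟩
    refine ⟨hI₂, fun i' hi' => ?_⟩
    rcases Nat.lt_succ_iff_lt_or_eq.1 hi' with hi' | rfl
    · exact fun j hj => (hE₁ i' hi' j hj).mono hβ₂
    · exact hE₂

/-! ### The program: output -/

/-- The increase of the cost of item `i` that is useful to the adversary at the prices `a`, `b`. -/
noncomputable def usefulIncrease (x : ℕ → ℕ) (lo hi : ℕ → ℝ) (a b : ℝ) (i : ℕ) : ℝ :=
  max 0 ((if x i = 1 then a else b) - lo i) - max 0 ((if x i = 1 then a else b) - hi i)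

/-- Serves the items greedily at the prices in the real variables 5 and 6.  While it runs, the real
variable 0 holds the remaining budget; at the end it receives the optimal value. -/
def writeScenario : Cmd :=
  .seq (.forLoop 4 0 (.seq
    (.ite (.conj (.idxLe (.read 0 (.var 4)) (.lit 1)) (.idxLe (.lit 1) (.read 0 (.var 4))))
      (.setReal 7 (.var 5)) (.setReal 7 (.var 6))) (.seq
    (.ite (.realLe (.var 7) (.read 0 (.var 4))) (.setReal 8 (.lit 0))
      (.ite (.realLe (.var 7) (.read 1 (.var 4))) (.setReal 8 (.sub (.var 7) (.read 0 (.var 4))))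
        (.setReal 8 (.sub (.read 1 (.var 4)) (.read 0 (.var 4)))))) (.seq
    (.ite (.realLe (.var 8) (.var 0)) .skip (.setReal 8 (.var 0))) (.seq
    (.writeReal 2 (.var 4) (.add (.read 0 (.var 4)) (.var 8)))
    (.setReal 0 (.sub (.var 0) (.var 8))))))))
  (.setReal 0 (.var 4))

theorem writeScenario_runs {n : ℕ} {x : ℕ → ℕ} {lo hi : ℕ → ℝ} {Γ a b β : ℝ} {s : State}
    (hn : s.idxVar 0 = n) (hx : s.idxArr 0 = x) (hlo : s.realArr 0 = lo) (hhi : s.realArr 1 = hi)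
    (hΓ : s.realVar 0 = Γ) (h4 : s.realVar 4 = β) (h5 : s.realVar 5 = a) (h6 : s.realVar 6 = b)
    (hlohi : ∀ i, lo i ≤ hi i) :
    Runs writeScenario s ((n + 1) * 100 + 2) fun s' => s'.realVar 0 = β ∧
      ∀ i < n, s'.realArr 2 i = lo i + (remaining Γ (usefulIncrease x lo hi a b) i -
        remaining Γ (usefulIncrease x lo hi a b) (i + 1)) := by
  set m := usefulIncrease x lo hi a b with hm
  refine Runs.seq (Runs.forLoop (T := 90) (fun l s' => s'.realVar 0 = remaining Γ m l ∧
    ∀ i < l, s'.realArr 2 i = lo i + (remaining Γ m i - remaining Γ m (i + 1))) hn (by decide)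
    (by decide) (by decide) ⟨hΓ, by simp⟩ ?_) ?_
  · rintro i hi' s₁ hf hvi ⟨hr, hI⟩
    rw [← hf.idxArr 0 (by decide)] at hx
    rw [← hf.realArr 0 (by decide)] at hlo
    rw [← hf.realArr 1 (by decide)] at hhi
    rw [← hf.realVar 5 (by decide)] at h5
    rw [← hf.realVar 6 (by decide)] at h6
    have hone : x i ≤ 1 ∧ 1 ≤ x i ↔ x i = 1 := le_antisymm_iff.symm
    refine Runs.imp (T := 15 + (35 + (10 + 20))) (Runs.seq
      (R := fun s' => s'.realVar 7 = if x i = 1 then a else b) (Runs.of_wp (by decide) ?_) ?_)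
      (by norm_num) fun _ _ h => h
    · simp only [Cmd.wp, RealExp.eval, IdxExp.eval, Test.holds, State.setReal, hvi, hx, h5, h6,
        hone, Function.update_self]
      exact ⟨fun h => (if_pos h).symm, fun h => (if_neg h).symm⟩
    intro s₂ hf₂ ht
    rw [← hf₂.idxVar 4 (by decide)] at hvi
    rw [← hf₂.realArr 0 (by decide)] at hlo
    rw [← hf₂.realArr 1 (by decide)] at hhi
    rw [← hf₂.realVar 0 (by decide)] at hr
    rw [← hf₂.realArr 2 (by decide)] at hI
    refine Runs.seq (R := fun s' => s'.realVar 8 = m i) (Runs.of_wp (by decide) ?_) ?_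
    · simp only [Cmd.wp, RealExp.eval, IdxExp.eval, Test.holds, State.setReal, hvi, hlo, hhi, ht,
        Function.update_self, hm, usefulIncrease]
      have hl := hlohi i
      generalize (if x i = 1 then a else b) = t
      refine ⟨fun h => ?_, fun h => ⟨fun h' => ?_, fun h' => ?_⟩⟩
      · rw [max_eq_left (by linarith), max_eq_left (by linarith)]; simp
      · rw [max_eq_right (by linarith), max_eq_left (by linarith), sub_zero]
      · rw [max_eq_right (by linarith), max_eq_right (by linarith)]; ring
    intro s₃ hf₃ hmi
    rw [← hf₃.idxVar 4 (by decide)] at hvi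
    rw [← hf₃.realArr 0 (by decide)] at hlo
    rw [← hf₃.realVar 0 (by decide)] at hr
    rw [← hf₃.realArr 2 (by decide)] at hI
    refine Runs.seq (R := fun s' => s'.realVar 8 = min (m i) (remaining Γ m i))
      (Runs.of_wp (by decide) ?_) ?_
    · simp only [Cmd.wp, RealExp.eval, Test.holds, State.setReal, hmi, hr, Function.update_self]
      exact ⟨fun h => (min_eq_left h).symm, fun h => (min_eq_right (not_le.1 h).le).symm⟩
    intro s₄ hf₄ hδ
    rw [← hf₄.idxVar 4 (by decide)] at hvi
    rw [← hf₄.realArr 0 (by decide)] at hlo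
    rw [← hf₄.realVar 0 (by decide)] at hr
    rw [← hf₄.realArr 2 (by decide)] at hI
    refine Runs.of_wp (by decide) ?_
    simp only [Cmd.wp, RealExp.eval, IdxExp.eval, State.setReal, State.writeReal, State.setIdx, hvi,
      hlo, hδ, hr, Function.update_self]
    refine ⟨rfl, fun l hl => ?_⟩
    rcases Nat.lt_succ_iff_lt_or_eq.1 hl with hl | rfl
    · rw [Function.update_of_ne hl.ne, hI l hl]
    · rw [Function.update_self, remaining]; ring
  · rintro s₁ hf ⟨-, hI⟩
    rw [← hf.realVar 4 (by decide)] at h4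
    refine Runs.of_wp (by decide) ?_
    simpa [Cmd.wp, RealExp.eval, State.setReal, h4] using hI

/-! ### Correctness and running time -/

theorem ChordLE.add_const {f : ℝ → ℝ} (h : ChordLE f) (r : ℝ) : ChordLE fun s => f s + r :=
  fun u u' t h0 h1 => by linarith [h u u' t h0 h1]

theorem hinge_zero {n : ℕ} (μ : ℝ) (x : Fin n → ℕ) (q : ℕ) {c : Fin n → ℝ} (hc : ∀ i, 0 ≤ c i) :
    hinge μ x q c 0 = 0 := by
  simp [hinge, hc]

section

variable {n : ℕ} (lo hi : Fin n → ℝ)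

theorem breakpoint_lo (i : Fin n) : breakpoint n (toArray lo) (toArray hi) i = lo i := by
  simp [breakpoint, toArray_apply]

theorem breakpoint_hi (i : Fin n) : breakpoint n (toArray lo) (toArray hi) (n + i) = hi i := by
  simp [breakpoint, toArray_apply]

theorem breakpoint_zero : breakpoint n (toArray lo) (toArray hi) (2 * n) = 0 := by
  rw [breakpoint, if_neg (by omega), toArray_of_le _ (by omega)]

end

/-- What the search and the greedy distribution of the budget guarantee makes their results an
optimal solution. -/
theorem isAdversarialSolution_of_cellBound {n p k : ℕ} {x : Fin n → ℕ} {lo hi c : Fin n → ℝ}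
    {Γ a b β : ℝ} {σ : ℕ → ℕ} {f₁ f₂ g₁ g₂ : ℝ → ℝ} {v : ℕ → ℝ} (hk : k ≤ p)
    (hx : x ∈ feasible n p) (hlo : ∀ i, 0 ≤ lo i) (hlohi : ∀ i, lo i ≤ hi i) (hΓ : 0 ≤ Γ)
    (hf₁ : f₁ = hinge ((p - k : ℕ) : ℝ) x 1 hi) (hf₂ : f₂ = hinge ((p - k : ℕ) : ℝ) x 1 lo)
    (hg₁ : g₁ = hinge (k : ℝ) x 0 hi) (hg₂ : g₂ = fun s => hinge (k : ℝ) x 0 lo s + Γ)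
    (hv : v = breakpoint n (toArray lo) (toArray hi))
    (hσ : ∀ j < 2 * n + 1, IsNext (2 * n + 1) v j (σ j)) (hatt : Attained f₁ f₂ g₁ g₂ β a b)
    (hcell : ∀ i < 2 * n + 1, ∀ j < 2 * n + 1, CellBound v σ f₁ f₂ g₁ g₂ β i j)
    (hc : ∀ i : Fin n, c i = lo i +
      (remaining Γ (usefulIncrease (toArray x) (toArray lo) (toArray hi) a b) i -
        remaining Γ (usefulIncrease (toArray x) (toArray lo) (toArray hi) a b) (i + 1))) :
    IsAdversarialSolution p k x lo hi Γ c β := by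
  have hvlo := fun i => hv ▸ breakpoint_lo lo hi i
  have hvhi := fun i => hv ▸ breakpoint_hi lo hi i
  have hv0 := hv ▸ breakpoint_zero lo hi
  have haff : ∀ (μ : ℝ) (q j : ℕ), j < 2 * n + 1 → AffineOn (hinge μ x q lo) (v j) (v (σ j)) ∧
      AffineOn (hinge μ x q hi) (v j) (v (σ j)) := by
    intro μ q j hj
    refine ⟨hinge_affineOn _ _ _ fun i => ?_, hinge_affineOn _ _ _ fun i => ?_⟩
    · rw [← hvlo i]
      exact ((hσ j hj).2.2 i (by omega)).imp id And.right
    · rw [← hvhi i]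
      exact ((hσ j hj).2.2 (n + i) (by omega)).imp id And.right
  have hadv : ∀ a b, advDual p k x lo hi Γ a b = min (f₁ a + g₁ b) (f₂ a + g₂ b) := by
    intro a b
    rw [advDual, dual, dual, hf₁, hf₂, hg₁, hg₂, add_assoc]
  have upper : ∀ c' ∈ budgetedScenarios lo hi Γ, ∃ y ∈ recoverySet p k x, cost c' y ≤ β := by
    intro c' hc'
    have hc'lo : ∀ i, 0 ≤ c' i := fun i => by
      obtain ⟨δ, hδ, -, h⟩ := hc'
      linarith [h i, hlo i, (hδ i).1]
    have hc'hi : ∀ i, c' i ≤ hi i := fun i => by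
      obtain ⟨δ, hδ, -, h⟩ := hc'
      linarith [h i, (hδ i).2]
    obtain ⟨y, hy, a', b', hb', hba', ha', hle⟩ := exists_dual_eq hx hk hc'lo
    refine ⟨y, hy, hle.trans ((dual_le_advDual hx.1 hc' a' b').trans ?_)⟩
    obtain ⟨l, hl, hal⟩ : ∃ l < 2 * n + 1, a' ≤ v l := by
      rcases ha' with rfl | ⟨i, rfl⟩
      · exact ⟨2 * n, by omega, hv0.ge⟩
      · exact ⟨n + i, by omega, by rw [hvhi]; exact hc'hi i⟩
    rw [hadv]
    refine le_of_edgeBound hσ ?_ ?_ ?_ ?_ hcell (z := 2 * n) (by omega) hl (by rw [hv0]; exact hb')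
      hba' hal
    · exact fun j hj => hf₁ ▸ (haff _ _ j hj).2
    · exact fun j hj => hf₂ ▸ (haff _ _ j hj).1
    · exact fun j hj => hg₁ ▸ (haff _ _ j hj).2
    · exact fun j hj => hg₂ ▸ (haff _ _ j hj).1.add_const Γ
  have hm0 : ∀ i, 0 ≤ usefulIncrease (toArray x) (toArray lo) (toArray hi) a b i := by
    intro i
    have : toArray lo i ≤ toArray hi i := by
      unfold toArray
      split_ifs
      · exact hlohi _
      · exact le_rfl
    exact sub_nonneg.2 (max_le_max le_rfl (by linarith))
  obtain ⟨hcU, hcdual⟩ := greedy_scenario (p := p) (k := k) hx.1 (a := a) (b := b) hlohi hΓ hm0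
    (fun i => by simp only [usefulIncrease, toArray_apply]) hc
  have lower : ∀ y ∈ recoverySet p k x, β ≤ cost c y := fun y hy => by
    refine le_trans ?_ (hcdual.trans (dual_le_cost hx.1 hk hy c hatt.1))
    rw [hadv]
    exact le_min hatt.2.1 hatt.2.2
  have hval : IsIncrementalValue p k x c β := by
    obtain ⟨y, hy, hle⟩ := upper c hcU
    refine ⟨⟨y, hy, le_antisymm hle (lower y hy)⟩, ?_⟩
    rintro _ ⟨z, hz, rfl⟩
    exact lower z hz
  refine ⟨hcU, hval, ⟨c, hcU, hval⟩, ?_⟩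
  rintro w ⟨c', hc', hw⟩
  obtain ⟨y, hy, hle⟩ := upper c' hc'
  exact (hw.2 ⟨y, hy, rfl⟩).trans hle

/-- The input, the number of breakpoints, and the trivial incumbent, which has value `0` at the
prices `0` and `0`, are in memory. -/
structure Prepared {n : ℕ} (x : Fin n → ℕ) (lo hi : Fin n → ℝ) (Γ : ℝ) (s : State) : Prop where
  size : s.idxVar 0 = n
  points : s.idxVar 3 = 2 * n + 1
  budget : s.realVar 0 = Γ
  value : s.realVar 4 = 0
  price₁ : s.realVar 5 = 0
  price₀ : s.realVar 6 = 0
  x : s.idxArr 0 = toArray x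
  lo : s.realArr 0 = toArray lo
  hi : s.realArr 1 = toArray hi

theorem Prepared.of_frame {n : ℕ} {x : Fin n → ℕ} {lo hi : Fin n → ℝ} {Γ : ℝ} {s s' : State}
    {P : Cmd} (h : Prepared x lo hi Γ s) (hf : Frame P s s')
    (h₁ : ∀ v ∈ [0, 3], v ∉ P.idxVars) (h₂ : ∀ v ∈ [0, 4, 5, 6], v ∉ P.realVars)
    (h₃ : 0 ∉ P.idxArrs) (h₄ : ∀ a ∈ [0, 1], a ∉ P.realArrs) : Prepared x lo hi Γ s' where
  size := (hf.idxVar 0 (h₁ 0 (by decide))).trans h.size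
  points := (hf.idxVar 3 (h₁ 3 (by decide))).trans h.points
  budget := (hf.realVar 0 (h₂ 0 (by decide))).trans h.budget
  value := (hf.realVar 4 (h₂ 4 (by decide))).trans h.value
  price₁ := (hf.realVar 5 (h₂ 5 (by decide))).trans h.price₁
  price₀ := (hf.realVar 6 (h₂ 6 (by decide))).trans h.price₀
  x := (hf.idxArr 0 h₃).trans h.x
  lo := (hf.realArr 0 (h₄ 0 (by decide))).trans h.lo
  hi := (hf.realArr 1 (h₄ 1 (by decide))).trans h.hi

/-- Solves the adversarial problem.  The index variable 3 holds the number of breakpoints, the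
index variable 8 holds `p - k`, and the real variables 1 and 2 hold the reals `k` and `p - k`, which
are obtained by counting because the machine does not convert indices. -/
def adversarialProgram : Cmd :=
  .seq (.seq (.setIdx 3 (.add (.add (.var 0) (.var 0)) (.lit 1)))
    (.setIdx 8 (.sub (.var 1) (.var 2))))
  (.seq (addCount 2 1) (.seq (addCount 8 2) (.seq storeBreakpoints (.seq (tabulate 1 1 2 4)
  (.seq (tabulate 0 1 2 5) (.seq (tabulate 1 0 1 6) (.seq (tabulate 0 0 1 7) (.seq storeNext
  (.seq searchGrid writeScenario)))))))))

theorem adversarialProgram_runs {n p k : ℕ} {x : Fin n → ℕ} {lo hi : Fin n → ℝ} {Γ : ℝ} (hp : 1 ≤ p)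
    (hpn : p ≤ n) (hk : k ≤ p) (hx : x ∈ feasible n p) (hlo : ∀ i, 0 ≤ lo i)
    (hlohi : ∀ i, lo i ≤ hi i) (hΓ : 0 ≤ Γ) :
    Runs adversarialProgram (inputState n p k x lo hi Γ) (20000 * n ^ 2) fun s =>
      IsAdversarialSolution p k x lo hi Γ (outputScenario n s) (outputValue s) := by
  obtain ⟨v, hv⟩ : ∃ v, v = breakpoint n (toArray lo) (toArray hi) := ⟨_, rfl⟩
  obtain ⟨f₁, hf₁⟩ : ∃ f, f = hinge ((p - k : ℕ) : ℝ) x 1 hi := ⟨_, rfl⟩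
  obtain ⟨f₂, hf₂⟩ : ∃ f, f = hinge ((p - k : ℕ) : ℝ) x 1 lo := ⟨_, rfl⟩
  obtain ⟨g₁, hg₁⟩ : ∃ f, f = hinge (k : ℝ) x 0 hi := ⟨_, rfl⟩
  obtain ⟨g₂, hg₂⟩ : ∃ f, f = fun s => hinge (k : ℝ) x 0 lo s + Γ := ⟨_, rfl⟩
  have hhi : ∀ i, 0 ≤ hi i := fun i => (hlo i).trans (hlohi i)
  have htime : 20 + ((k + 1) * 14 + ((p - k + 1) * 14 + ((n + 1) * 20 +
      ((2 * n + 1 + 1) * (9 + (n + 1) * 40 + 10) + ((2 * n + 1 + 1) * (9 + (n + 1) * 40 + 10) +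
      ((2 * n + 1 + 1) * (9 + (n + 1) * 40 + 10) + ((2 * n + 1 + 1) * (9 + (n + 1) * 40 + 10) +
      ((2 * n + 1 + 1) * (5 + (2 * n + 1 + 1) * 40 + 10) +
      ((2 * n + 1 + 1) * ((2 * n + 1 + 1) * 1010 + 10) + ((n + 1) * 100 + 2)))))))))) ≤
      20000 * n ^ 2 := by
    have h1 : k ≤ n := hk.trans hpn
    have h2 : p - k ≤ n := (Nat.sub_le _ _).trans hpn
    have h3 : 1 ≤ n := hp.trans hpn
    have h4 : n ≤ n ^ 2 := Nat.le_self_pow (by norm_num) n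
    nlinarith
  refine Runs.imp (Runs.seq (T := 20) (R := fun s => s.idxVar 3 = 2 * n + 1 ∧ s.idxVar 8 = p - k)
    (Runs.of_wp (by decide) ?_) ?_) htime fun _ _ h => h
  · simp [Cmd.wp, IdxExp.eval, State.setIdx, inputState, two_mul]
  rintro s hf ⟨h3, h8⟩
  have hM : Prepared x lo hi Γ s :=
    ⟨(hf.idxVar 0 (by decide)).trans (by simp [inputState]), h3,
      (hf.realVar 0 (by decide)).trans (by simp [inputState]),
      (hf.realVar 4 (by decide)).trans (by simp [inputState]),
      (hf.realVar 5 (by decide)).trans (by simp [inputState]),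
      (hf.realVar 6 (by decide)).trans (by simp [inputState]),
      (hf.idxArr 0 (by decide)).trans (by simp [inputState]),
      (hf.realArr 0 (by decide)).trans (by simp [inputState]),
      (hf.realArr 1 (by decide)).trans (by simp [inputState])⟩
  have i2 : s.idxVar 2 = k := (hf.idxVar 2 (by decide)).trans (by simp [inputState])
  have r1 : s.realVar 1 = 0 := (hf.realVar 1 (by decide)).trans (by simp [inputState])
  have r2 : s.realVar 2 = 0 := (hf.realVar 2 (by decide)).trans (by simp [inputState])
  have b3 : s.realArr 3 = 0 := (hf.realArr 3 (by decide)).trans (by simp [inputState])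
  clear hf h3
  refine Runs.seq (addCount_runs (by decide) i2 r1) ?_
  clear r1 i2
  intro s₁ hf r1
  rw [← hf.idxVar 8 (by decide)] at h8
  rw [← hf.realVar 2 (by decide)] at r2
  rw [← hf.realArr 3 (by decide)] at b3
  replace hM := hM.of_frame hf (by decide) (by decide) (by decide) (by decide)
  clear hf
  refine Runs.seq (addCount_runs (by decide) h8 r2) ?_
  clear r2
  intro s₂ hf r2
  rw [← hf.realVar 1 (by decide)] at r1
  rw [← hf.realArr 3 (by decide)] at b3
  replace hM := hM.of_frame hf (by decide) (by decide) (by decide) (by decide)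
  clear hf h8
  refine Runs.seq (storeBreakpoints_runs hM.size hM.lo hM.hi b3 fun i => toArray_of_le hi) ?_
  clear b3
  intro s₃ hf b3
  rw [← hf.realVar 1 (by decide)] at r1
  rw [← hf.realVar 2 (by decide)] at r2
  rw [← hv] at b3
  replace hM := hM.of_frame hf (by decide) (by decide) (by decide) (by decide)
  clear hf
  refine Runs.seq (tabulate_runs (by decide) (by decide) (by decide) hM.size hM.points hM.x hM.hi r2
    b3) ?_
  intro s₄ hf b4
  rw [← hf.realVar 1 (by decide)] at r1
  rw [← hf.realVar 2 (by decide)] at r2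
  rw [← hf.realArr 3 (by decide)] at b3
  replace hM := hM.of_frame hf (by decide) (by decide) (by decide) (by decide)
  clear hf
  refine Runs.seq (tabulate_runs (by decide) (by decide) (by decide) hM.size hM.points hM.x hM.lo r2
    b3) ?_
  intro s₅ hf b5
  rw [← hf.realVar 1 (by decide)] at r1
  rw [← hf.realArr 3 (by decide)] at b3
  rw [← hf.realArr 4 (by decide)] at b4
  replace hM := hM.of_frame hf (by decide) (by decide) (by decide) (by decide)
  clear hf
  refine Runs.seq (tabulate_runs (by decide) (by decide) (by decide) hM.size hM.points hM.x hM.hi r1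
    b3) ?_
  intro s₆ hf b6
  rw [← hf.realVar 1 (by decide)] at r1
  rw [← hf.realArr 3 (by decide)] at b3
  rw [← hf.realArr 4 (by decide)] at b4
  rw [← hf.realArr 5 (by decide)] at b5
  replace hM := hM.of_frame hf (by decide) (by decide) (by decide) (by decide)
  clear hf
  refine Runs.seq (tabulate_runs (by decide) (by decide) (by decide) hM.size hM.points hM.x hM.lo r1
    b3) ?_
  intro s₇ hf b7
  rw [← hf.realArr 3 (by decide)] at b3
  rw [← hf.realArr 4 (by decide)] at b4
  rw [← hf.realArr 5 (by decide)] at b5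
  rw [← hf.realArr 6 (by decide)] at b6
  replace hM := hM.of_frame hf (by decide) (by decide) (by decide) (by decide)
  clear hf
  have hT : Tables (2 * n + 1) v f₁ f₂ g₁ g₂ s₇ :=
    ⟨b3, hf₁ ▸ b4, hf₂ ▸ b5, hg₁ ▸ b6, fun j hj => by rw [b7 j hj, hM.budget, hg₂]⟩
  refine Runs.seq (storeNext_runs hM.points b3) ?_
  intro s₈ hf hσ
  replace hM := hM.of_frame hf (by decide) (by decide) (by decide) (by decide)
  replace hT := hT.of_frame hf rfl (by decide)
  clear hf
  have hI : Incumbent f₁ f₂ g₁ g₂ s₈ := by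
    rw [Incumbent, hM.value, hM.price₁, hM.price₀, hf₁, hf₂, hg₁, hg₂]
    simp [Attained, hinge_zero _ _ _ hlo, hinge_zero _ _ _ hhi, hΓ]
  refine Runs.seq (searchGrid_runs (hf₁ ▸ hinge_chordLE _ _ _ _) (hf₂ ▸ hinge_chordLE _ _ _ _)
    (hg₁ ▸ hinge_chordLE _ _ _ _) (hg₂ ▸ (hinge_chordLE _ _ _ _).add_const Γ) hT hI hM.points rfl
    fun j hj => (hσ j hj).1) ?_
  rintro s₉ hf ⟨hatt, hcell⟩
  refine (writeScenario_runs ((hf.idxVar 0 (by decide)).trans hM.size)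
    ((hf.idxArr 0 (by decide)).trans hM.x) ((hf.realArr 0 (by decide)).trans hM.lo)
    ((hf.realArr 1 (by decide)).trans hM.hi) ((hf.realVar 0 (by decide)).trans hM.budget)
    rfl rfl rfl fun i => ?_).imp le_rfl ?_
  · unfold toArray
    split_ifs
    · exact hlohi _
    · exact le_rfl
  · rintro s' - ⟨hval, hc⟩
    rw [outputValue, hval]
    refine isAdversarialSolution_of_cellBound hk hx hlo hlohi hΓ hf₁ hf₂ hg₁ hg₂ hv hσ hatt hcell
      fun i => ?_
    rw [outputScenario, hc i i.2, toArray_apply]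

end Selection

theorem mainTheorem3 :
    ∃ (P : RealRAM.Cmd) (K : ℕ), ∀ (n p k : ℕ) (x : Fin n → ℕ) (lo hi : Fin n → ℝ) (Γ : ℝ),
      1 ≤ p → p ≤ n → k ≤ p → x ∈ Selection.feasible n p →
      (∀ i, 0 ≤ lo i) → (∀ i, lo i ≤ hi i) → 0 ≤ Γ →
      ∃ (s : RealRAM.State) (t : ℕ),
        RealRAM.Exec P (Selection.inputState n p k x lo hi Γ) s t ∧ t ≤ K * n ^ 2 ∧
        Selection.IsAdversarialSolution p k x lo hi Γ
          (Selection.outputScenario n s) (Selection.outputValue s) :=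
  ⟨Selection.adversarialProgram, 20000, fun _ _ _ _ _ _ _ hp hpn hk hx hlo hlohi hΓ =>
    Selection.adversarialProgram_runs hp hpn hk hx hlo hlohi hΓ⟩
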